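/- Let $\mathcal{L}_{PA}$ be the first-order language of arithmetic with symbols $0,1,+,\cdot,<$, and let $M$ be a model of $\mathrm{Th}(\mathbb{N})$, the set of all $\mathcal{L}_{PA}$-sentences true in $\mathbb{N}$. Let $-M\cup M$ be the ordered ring obtained from $M$ by adjoining negatives. A \emph{pre-real over $M$} is a function $f\colon M\to(-M\cup M)\times(M\setminus\{0\})$ whose graph is definable in $M$ by $\mathcal{L}_{PA}$-formulas with parameters from $M$ (the values whose first coordinate lies in $M$ and those whose first coordinate lies in $-M$ each being described by a formula); if $f(i)=(a,b)$ we write $x_i=\frac{a}{b}$ and identify $f$ with the sequence $x=(x_i)_{i\in M}$ of fractions. A pre-real $x$ is an \emph{$M$-real} if it is convergent, i.e. for every $m\in M$ there is $n\in M$ such that $m(x_{k_1}-x_{k_2})<1$ for all $k_1,k_2\in M$ with $k_1,k_2>n$. Two $M$-reals $x,y$ are equivalent if for every $m\in M$ there is $n\in M$ such that $m|x_k-y_k|<1$ for all $k\in M$ with $k>n$. Let $K_M$ be the set of equivalence classes of $M$-reals, with addition and multiplication induced by the termwise operations $\frac{a}{b}+\frac{c}{d}=\frac{ad+bc}{bd}$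 and $\frac{a}{b}\cdot\frac{c}{d}=\frac{ac}{bd}$, and with the order in which the class of $x$ is less than the class of $y$ iff there are $m,k\in M$ such that $m x_l+1<m y_l$ for all $l\in M$ with $l>k$. With these operations and this order, $K_M$ is an ordered field. Then $K_M$ is real closed: every positive element of $K_M$ is a square in $K_M$, and every polynomial of odd degree with coefficients in $K_M$ has a root in $K_M$. -/

import Mathlib

open FirstOrder FirstOrder.Language

/-- Function symbols `0, 1, +, ·` of the language of arithmetic. -/
inductive PAFunc : ℕ → Type
  | zero : PAFunc 0
  | one : PAFunc 0
  | add : PAFunc 2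
  | mul : PAFunc 2

/-- The relation symbol `<` of the language of arithmetic. -/
inductive PARel : ℕ → Type
  | lt : PARel 2

/-- The first-order language of arithmetic `(0, 1, +, ·, <)`. -/
def LPA : Language := ⟨PAFunc, PARel⟩

/-- The standard model of arithmetic on `ℕ`. -/
instance natStructure : LPA.Structure ℕ where
  funMap
    | .zero, _ => 0
    | .one, _ => 1
    | .add, v => v 0 + v 1
    | .mul, v => v 0 * v 1
  RelMap
    | .lt, v => v 0 < v 1

/-- True arithmetic `Th(ℕ)`: all sentences of the language of arithmetic that hold in `ℕ`. -/
def ThNat : LPA.Theory := LPA.completeTheory ℕ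

namespace TrueArith

universe u

/-! ### A model of true arithmetic as an ordered semiring -/

section Model

variable {M : Type u} [LPA.Structure M]

/-- Every formula that holds of all tuples in `ℕ` holds of all tuples in a model of `Th(ℕ)`. -/
theorem transfer [M ⊨ ThNat] {n : ℕ} (φ : LPA.Formula (Fin n))
    (h : ∀ v : Fin n → ℕ, φ.Realize v) (v : Fin n → M) : φ.Realize v := by
  let ψ : LPA.Sentence := Formula.iAlls (α := Empty) (Fin n) (φ.relabel Sum.inr)
  have h1 : ℕ ⊨ ψ := by
    simp only [Sentence.Realize, ψ, Formula.realize_iAlls, Formula.realize_relabel]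
    exact fun i => h i
  have h2 : M ⊨ ψ := Theory.realize_sentence_of_mem ThNat h1
  simp only [Sentence.Realize, ψ, Formula.realize_iAlls, Formula.realize_relabel] at h2
  exact h2 v

/-! The operations and the order of a structure are the interpretations of the symbols. -/

instance (priority := 50) instZero : Zero M := ⟨Structure.funMap (L := LPA) PAFunc.zero ![]⟩
instance (priority := 50) instOne : One M := ⟨Structure.funMap (L := LPA) PAFunc.one ![]⟩
instance (priority := 50) instAdd : Add M :=
  ⟨fun a b => Structure.funMap (L := LPA) PAFunc.add ![a, b]⟩
instance (priority := 50) instMul : Mul M :=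
  ⟨fun a b => Structure.funMap (L := LPA) PAFunc.mul ![a, b]⟩
instance (priority := 50) instLT : LT M :=
  ⟨fun a b => Structure.RelMap (L := LPA) PARel.lt ![a, b]⟩
instance (priority := 50) instLE : LE M := ⟨fun a b => a < b ∨ a = b⟩

section Terms

variable {α : Type}

/-- Terms and atomic formulas of the language of arithmetic. -/
def tz : LPA.Term α := Term.func PAFunc.zero ![]
def tone : LPA.Term α := Term.func PAFunc.one ![]
def ta (s t : LPA.Term α) : LPA.Term α := Term.func PAFunc.add ![s, t]
def tm (s t : LPA.Term α) : LPA.Term α := Term.func PAFunc.mul ![s, t]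
def tlt (s t : LPA.Term α) : LPA.Formula α :=
  BoundedFormula.rel (PARel.lt : LPA.Relations 2) ![s.relabel Sum.inl, t.relabel Sum.inl]

variable (v : α → M) (w : α → ℕ) (s t : LPA.Term α)

theorem re_tz : (tz : LPA.Term α).realize v = (0 : M) := by
  show Structure.funMap _ _ = Structure.funMap _ _
  congr 1; ext i; exact i.elim0
theorem re_tone : (tone : LPA.Term α).realize v = (1 : M) := by
  show Structure.funMap _ _ = Structure.funMap _ _
  congr 1; ext i; exact i.elim0
theorem re_ta : (ta s t).realize v = s.realize v + t.realize v := by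
  show Structure.funMap _ _ = Structure.funMap _ _
  congr 1; ext i; fin_cases i <;> rfl
theorem re_tm : (tm s t).realize v = s.realize v * t.realize v := by
  show Structure.funMap _ _ = Structure.funMap _ _
  congr 1; ext i; fin_cases i <;> rfl
theorem re_tlt : (tlt s t).Realize v ↔ s.realize v < t.realize v := by
  show Structure.RelMap _ _ ↔ Structure.RelMap _ _
  apply iff_of_eq
  congr 1; ext i; fin_cases i <;> simp

theorem nat_tz : (tz : LPA.Term α).realize w = 0 := rfl
theorem nat_tone : (tone : LPA.Term α).realize w = 1 := rfl
theorem nat_ta : (ta s t).realize w = s.realize w + t.realize w := rfl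
theorem nat_tm : (tm s t).realize w = s.realize w * t.realize w := rfl
theorem nat_tlt : (tlt s t).Realize w ↔ s.realize w < t.realize w := by
  show (s.relabel Sum.inl).realize _ < (t.relabel Sum.inl).realize _ ↔ _
  simp

end Terms

variable [M ⊨ ThNat]

theorem transferEq {n : ℕ} (s t : LPA.Term (Fin n))
    (h : ∀ v : Fin n → ℕ, s.realize v = t.realize v) (v : Fin n → M) :
    s.realize v = t.realize v := by
  have := transfer (M := M) (s.equal t) (fun v => by simpa using h v) v
  simpa using this

/-- The variable with index `i`. -/
abbrev x {n : ℕ} (i : Fin n) : LPA.Term (Fin n) := Term.var i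

theorem add_assoc' (a b c : M) : a + b + c = a + (b + c) := by
  simpa [re_ta] using transferEq (ta (ta (x 0) (x 1)) (x 2)) (ta (x 0) (ta (x 1) (x 2)))
    (fun v => by simp [nat_ta, add_assoc]) ![a, b, c]

theorem zero_add' (a : M) : 0 + a = a := by
  simpa [re_ta, re_tz] using transferEq (ta tz (x 0)) (x 0)
    (fun v => by simp [nat_ta, nat_tz]) ![a]

theorem add_comm' (a b : M) : a + b = b + a := by
  simpa [re_ta] using transferEq (ta (x 0) (x 1)) (ta (x 1) (x 0))
    (fun v => by simp [nat_ta, add_comm]) ![a, b]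

theorem mul_assoc' (a b c : M) : a * b * c = a * (b * c) := by
  simpa [re_tm] using transferEq (tm (tm (x 0) (x 1)) (x 2)) (tm (x 0) (tm (x 1) (x 2)))
    (fun v => by simp [nat_tm, mul_assoc]) ![a, b, c]

theorem one_mul' (a : M) : 1 * a = a := by
  simpa [re_tm, re_tone] using transferEq (tm tone (x 0)) (x 0)
    (fun v => by simp [nat_tm, nat_tone]) ![a]

theorem zero_mul' (a : M) : 0 * a = 0 := by
  simpa [re_tm, re_tz] using transferEq (tm tz (x 0)) tz
    (fun v => by simp [nat_tm, nat_tz]) ![a]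

theorem mul_comm' (a b : M) : a * b = b * a := by
  simpa [re_tm] using transferEq (tm (x 0) (x 1)) (tm (x 1) (x 0))
    (fun v => by simp [nat_tm, mul_comm]) ![a, b]

theorem left_distrib' (a b c : M) : a * (b + c) = a * b + a * c := by
  simpa [re_tm, re_ta] using
    transferEq (tm (x 0) (ta (x 1) (x 2))) (ta (tm (x 0) (x 1)) (tm (x 0) (x 2)))
    (fun v => by simp [nat_tm, nat_ta, mul_add]) ![a, b, c]

theorem lt_irrefl' (a : M) : ¬ a < a := by
  simpa [re_tlt] using transfer (tlt (x 0) (x 0)).not (fun v => by simp [nat_tlt]) ![a]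

theorem lt_trans' (a b c : M) : a < b → b < c → a < c := by
  simpa [re_tlt] using transfer ((tlt (x 0) (x 1)).imp ((tlt (x 1) (x 2)).imp (tlt (x 0) (x 2))))
    (fun v => by simpa [nat_tlt] using lt_trans) ![a, b, c]

theorem lt_total' (a b : M) : a < b ∨ a = b ∨ b < a := by
  simpa [re_tlt] using transfer (tlt (x 0) (x 1) ⊔ ((x 0).equal (x 1) ⊔ tlt (x 1) (x 0)))
    (fun v => by simpa [nat_tlt] using lt_trichotomy _ _) ![a, b]

theorem add_lt_add' (a b c : M) : a < b → a + c < b + c := by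
  simpa [re_tlt, re_ta] using
    transfer ((tlt (x 0) (x 1)).imp (tlt (ta (x 0) (x 2)) (ta (x 1) (x 2))))
    (fun v => by simp [nat_tlt, nat_ta]) ![a, b, c]

theorem mul_lt_mul' (a b c : M) : 0 < c → a < b → a * c < b * c := by
  simpa [re_tlt, re_tm, re_tz] using
    transfer ((tlt tz (x 2)).imp ((tlt (x 0) (x 1)).imp (tlt (tm (x 0) (x 2)) (tm (x 1) (x 2)))))
    (fun v => by
      simpa [nat_tlt, nat_tm, nat_tz] using fun h h' => (Nat.mul_lt_mul_right h).2 h') ![a, b, c]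

theorem not_lt_zero' (a : M) : ¬ a < 0 := by
  simpa [re_tlt, re_tz] using transfer (tlt (x 0) tz).not (fun v => by simp [nat_tlt, nat_tz]) ![a]

theorem zero_lt_one' : (0 : M) < 1 := by
  simpa [re_tlt, re_tz, re_tone] using transfer (tlt (tz : LPA.Term (Fin 0)) tone)
    (fun v => by simp [nat_tlt, nat_tz, nat_tone]) (![] : Fin 0 → M)

theorem not_lt_one' (a : M) : 0 < a → ¬ a < 1 := by
  simpa [re_tlt, re_tz, re_tone] using transfer ((tlt tz (x 0)).imp (tlt (x 0) tone).not)
    (fun v => by simp [nat_tlt, nat_tz, nat_tone]; omega) ![a]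

theorem exists_add' (a b : M) : a < b → ∃ c, b = a + c := by
  have := transfer (M := M) ((tlt (x 0) (x 1)).imp (Formula.iExs (Fin 1)
    (((Term.var (Sum.inl 1)).equal (ta (Term.var (Sum.inl 0)) (Term.var (Sum.inr 0))) :
      LPA.Formula (Fin 2 ⊕ Fin 1)))))
    (fun v => by
      simp only [Formula.realize_imp, nat_tlt, Formula.realize_iExs, Formula.realize_equal,
        nat_ta, Term.realize_var, Sum.elim_inl, Sum.elim_inr]
      exact fun h => ⟨fun _ => v 1 - v 0, (Nat.add_sub_cancel' h.le).symm⟩) ![a, b]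
  simp only [Formula.realize_imp, re_tlt, Formula.realize_iExs, Formula.realize_equal,
        re_ta, Term.realize_var, Sum.elim_inl, Sum.elim_inr] at this
  intro h
  obtain ⟨i, hi⟩ := this h
  exact ⟨i 0, hi⟩

instance (priority := 50) instCommSemiring : CommSemiring M where
  add_assoc := add_assoc'
  zero_add := zero_add'
  add_zero a := by rw [add_comm', zero_add']
  add_comm := add_comm'
  mul_assoc := mul_assoc'
  one_mul := one_mul'
  mul_one a := by rw [mul_comm', one_mul']
  zero_mul := zero_mul'
  mul_zero a := by rw [mul_comm', zero_mul']
  mul_comm := mul_comm'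
  left_distrib := left_distrib'
  right_distrib a b c := by rw [mul_comm', left_distrib', mul_comm' c a, mul_comm' c b]
  nsmul := nsmulRec
  npow := npowRec

noncomputable instance (priority := 50) instLinearOrder : LinearOrder M where
  le_refl a := Or.inr rfl
  le_trans a b c := by
    rintro (h | rfl) (h' | rfl)
    · exact Or.inl (lt_trans' _ _ _ h h')
    · exact Or.inl h
    · exact Or.inl h'
    · exact Or.inr rfl
  lt_iff_le_not_ge a b := by
    constructor
    · refine fun h => ⟨Or.inl h, ?_⟩
      rintro (h' | rfl)
      · exact lt_irrefl' _ (lt_trans' _ _ _ h h')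
      · exact lt_irrefl' _ h
    · rintro ⟨h | rfl, h'⟩
      · exact h
      · exact absurd (Or.inr rfl) h'
  le_antisymm a b := by
    rintro (h | rfl) (h' | h')
    · exact absurd (lt_trans' _ _ _ h h') (lt_irrefl' _)
    · exact h'.symm
    · rfl
    · rfl
  le_total a b := by
    rcases lt_total' a b with h | h | h
    · exact Or.inl (Or.inl h)
    · exact Or.inl (Or.inr h)
    · exact Or.inr (Or.inl h)
  toDecidableLE := Classical.decRel _
  toDecidableLT := Classical.decRel _
  toDecidableEq := Classical.decEq _

instance (priority := 50) instNontrivial : Nontrivial M :=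
  ⟨⟨0, 1, (zero_lt_one' (M := M)).ne⟩⟩

instance (priority := 50) instIsStrictOrderedRing : IsStrictOrderedRing M := by
  have h1 : ∀ a b : M, a ≤ b → ∀ c, a + c ≤ b + c := by
    rintro a b (h | rfl) c
    · exact Or.inl (add_lt_add' _ _ _ h)
    · exact le_rfl
  have h2 : ∀ a b c : M, a + c ≤ b + c → a ≤ b := by
    intro a b c h
    by_contra hn
    exact absurd (add_lt_add' _ _ c (not_le.1 hn)) (not_lt.2 h)
  exact
  { add_le_add_left := fun a b h c => h1 a b h c
    le_of_add_le_add_left := fun a b c h => h2 b c a (by rwa [add_comm b, add_comm c])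
    zero_le_one := (zero_lt_one' (M := M)).le
    mul_lt_mul_of_pos_right := fun c hc a b h => mul_lt_mul' a b c hc h
    mul_lt_mul_of_pos_left := fun c hc a b h => by
      simp only [mul_comm c]
      exact mul_lt_mul' a b c hc h }

theorem zero_le' (a : M) : 0 ≤ a := not_lt.1 (not_lt_zero' a)

theorem one_le_of_ne {a : M} (h : a ≠ 0) : 1 ≤ a :=
  not_lt.1 (not_lt_one' a (lt_of_le_of_ne (zero_le' a) h.symm))

end Model

/-! ### The ring `-M ∪ M` and its fraction field -/

section Int

variable (M : Type u) [LPA.Structure M] [M ⊨ ThNat]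

/-- The ring `-M ∪ M` of differences of elements of `M`; see `MInt.eq_or_eq_neg`. -/
abbrev MInt : Type u := Algebra.GrothendieckAddGroup M

namespace MInt

/-- The inclusion of `M` in `-M ∪ M`. -/
noncomputable def of : M →+ MInt M := Algebra.GrothendieckAddGroup.of

variable {M}

theorem of_lt {a b : M} : of M a < of M b ↔ a < b := by
  show (AddLocalization.mk a 0 : Algebra.GrothendieckAddGroup M) < AddLocalization.mk b 0 ↔ _
  rw [AddLocalization.mk_lt_mk]
  simp

theorem of_inj {a b : M} : of M a = of M b ↔ a = b := by
  refine ⟨fun h => ?_, fun h => h ▸ rfl⟩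
  rcases lt_trichotomy a b with h' | h' | h'
  · exact absurd h (of_lt.2 h').ne
  · exact h'
  · exact absurd h (of_lt.2 h').ne'

theorem exists_sub (z : MInt M) : ∃ a b : M, z = of M a - of M b := by
  induction z using AddLocalization.ind with
  | _ y =>
    refine ⟨y.1, y.2, ?_⟩
    show AddLocalization.mk y.1 y.2 = (AddLocalization.mk y.1 0 : MInt M)
      - AddLocalization.mk (y.2 : M) 0
    rw [Algebra.GrothendieckAddGroup.mk_sub_mk]
    congr 1
    · simp
    · ext; simp

/-- Every element of the ring is an element of `M` or the negative of one. -/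
theorem eq_or_eq_neg (z : MInt M) : ∃ a : M, z = of M a ∨ z = -of M a := by
  obtain ⟨a, b, rfl⟩ := exists_sub z
  rcases lt_trichotomy a b with h | rfl | h
  · obtain ⟨c, rfl⟩ := exists_add' _ _ h
    exact ⟨c, Or.inr (by simp)⟩
  · exact ⟨0, Or.inl (by simp)⟩
  · obtain ⟨c, rfl⟩ := exists_add' _ _ h
    exact ⟨c, Or.inl (by simp)⟩

theorem hom_ext {G : Type*} [AddCommGroup G] {f g : MInt M →+ G}
    (h : ∀ a, f (of M a) = g (of M a)) : f = g := by
  ext z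
  obtain ⟨a, b, rfl⟩ := exists_sub z
  simp [h]

theorem lift_of {G : Type*} [AddCommGroup G] (f : M →+ G) (a : M) :
    Algebra.GrothendieckAddGroup.lift f (of M a) = f a :=
  DFunLike.congr_fun (Algebra.GrothendieckAddGroup.lift.symm_apply_apply f) a

variable (M) in
/-- Multiplication, as the biadditive extension of the multiplication of `M`. -/
noncomputable def mulHom : MInt M →+ MInt M →+ MInt M :=
  Algebra.GrothendieckAddGroup.lift
    { toFun := fun a => Algebra.GrothendieckAddGroup.lift
        ((of M).comp (AddMonoidHom.mulLeft a))
      map_zero' := hom_ext fun b => by simp [lift_of]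
      map_add' := fun a a' => hom_ext fun b => by simp [lift_of, add_mul] }

noncomputable instance : Mul (MInt M) := ⟨fun y z => mulHom M y z⟩
noncomputable instance : One (MInt M) := ⟨of M 1⟩

theorem of_mul (a b : M) : of M (a * b) = of M a * of M b := by
  show _ = mulHom M _ _
  simp [mulHom, lift_of]

theorem of_one : of M 1 = 1 := rfl

theorem mul_sub' (x y z : MInt M) : x * (y - z) = x * y - x * z := (mulHom M x).map_sub y z

theorem sub_mul' (x y z : MInt M) : (x - y) * z = x * z - y * z := by
  show mulHom M (x - y) z = _
  rw [map_sub]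
  rfl

theorem mul_add' (x y z : MInt M) : x * (y + z) = x * y + x * z := (mulHom M x).map_add y z

theorem add_mul' (x y z : MInt M) : (x + y) * z = x * z + y * z := by
  show mulHom M (x + y) z = _
  rw [map_add]
  rfl

theorem mul_comm' (y z : MInt M) : y * z = z * y := by
  obtain ⟨a, b, rfl⟩ := exists_sub y
  obtain ⟨c, d, rfl⟩ := exists_sub z
  simp only [mul_sub', sub_mul', ← of_mul, mul_comm]
  abel

theorem one_mul' (y : MInt M) : 1 * y = y := by
  obtain ⟨a, b, rfl⟩ := exists_sub y
  simp only [mul_sub', ← of_one, ← of_mul, one_mul]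

noncomputable instance : CommRing (MInt M) where
  __ := (inferInstance : AddCommGroup (MInt M))
  left_distrib := mul_add'
  right_distrib := add_mul'
  zero_mul z := by simpa using sub_mul' 0 0 z
  mul_zero z := by simpa using mul_sub' z 0 0
  mul_assoc x y z := by
    obtain ⟨a, b, rfl⟩ := exists_sub x
    obtain ⟨c, d, rfl⟩ := exists_sub y
    obtain ⟨e, f, rfl⟩ := exists_sub z
    simp only [mul_sub', sub_mul', ← of_mul, mul_assoc]
  one_mul := one_mul'
  mul_one z := by rw [mul_comm', one_mul']
  mul_comm := mul_comm'

theorem of_pos {a : M} : 0 < of M a ↔ 0 < a := by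
  rw [← of_lt, map_zero]

theorem of_nonneg (a : M) : 0 ≤ of M a := by
  rcases (zero_le' a).lt_or_eq with h | rfl
  · exact (of_pos.2 h).le
  · simp

theorem exists_of_nonneg {z : MInt M} (h : 0 ≤ z) : ∃ a, z = of M a := by
  obtain ⟨a, rfl | rfl⟩ := eq_or_eq_neg z
  · exact ⟨a, rfl⟩
  · exact ⟨0, le_antisymm (by simpa using of_nonneg a) (by simpa using h)⟩

instance : ZeroLEOneClass (MInt M) := ⟨of_nonneg 1⟩

instance : Nontrivial (MInt M) := ⟨0, 1, by
  rw [← of_one, ← map_zero (of M), Ne, of_inj]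
  exact zero_ne_one⟩

instance : IsStrictOrderedRing (MInt M) := .of_mul_pos fun y z hy hz => by
  obtain ⟨a, rfl⟩ := exists_of_nonneg hy.le
  obtain ⟨b, rfl⟩ := exists_of_nonneg hz.le
  rw [← of_mul, of_pos]
  exact mul_pos (of_pos.1 hy) (of_pos.1 hz)

end MInt

/-- The fraction field of `-M ∪ M`. -/
abbrev FracM : Type u := FractionRing (MInt M)

namespace FracM

/-- The nonnegative fractions: quotients `a / b` with `0 ≤ a` and `0 < b`. -/
noncomputable def cone : RingCone (FracM M) where
  carrier := {q | ∃ a b : MInt M, 0 ≤ a ∧ 0 < b ∧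
    q = algebraMap (MInt M) (FracM M) a / algebraMap (MInt M) (FracM M) b}
  zero_mem' := ⟨0, 1, le_rfl, zero_lt_one, by simp⟩
  one_mem' := ⟨1, 1, zero_le_one, zero_lt_one, by simp⟩
  add_mem' := by
    rintro _ _ ⟨a, b, ha, hb, rfl⟩ ⟨c, d, hc, hd, rfl⟩
    refine ⟨a * d + b * c, b * d, by positivity, by positivity, ?_⟩
    rw [div_add_div _ _ (by simpa using hb.ne') (by simpa using hd.ne')]
    simp
  mul_mem' := by
    rintro _ _ ⟨a, b, ha, hb, rfl⟩ ⟨c, d, hc, hd, rfl⟩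
    refine ⟨a * c, b * d, by positivity, by positivity, ?_⟩
    rw [div_mul_div_comm]
    simp
  eq_zero_of_mem_of_neg_mem' := by
    rintro _ ⟨a, b, ha, hb, rfl⟩ ⟨c, d, hc, hd, h⟩
    have hb' : algebraMap (MInt M) (FracM M) b ≠ 0 := by simpa using hb.ne'
    have hd' : algebraMap (MInt M) (FracM M) d ≠ 0 := by simpa using hd.ne'
    rw [← neg_div, div_eq_div_iff hb' hd', ← map_neg, ← map_mul, ← map_mul] at h
    have h' := FaithfulSMul.algebraMap_injective (MInt M) (FracM M) h
    have h1 : 0 ≤ a * d := by positivity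
    have h2 : 0 ≤ c * b := by positivity
    have h3 : a * d = 0 := by linarith
    have : a = 0 := (mul_eq_zero.1 h3).resolve_right hd.ne'
    simp [this]

variable {M}

theorem exists_div (q : FracM M) : ∃ a b : MInt M, 0 < b ∧
    q = algebraMap (MInt M) (FracM M) a / algebraMap (MInt M) (FracM M) b := by
  obtain ⟨a, b, hb, rfl⟩ := IsFractionRing.div_surjective (A := MInt M) q
  have hb : b ≠ 0 := nonZeroDivisors.ne_zero hb
  rcases lt_or_gt_of_ne hb with h | h
  · exact ⟨-a, -b, by simpa using h, by simp [neg_div_neg_eq]⟩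
  · exact ⟨a, b, h, rfl⟩

instance : HasMemOrNegMem (cone M) := ⟨fun q => by
  obtain ⟨a, b, hb, rfl⟩ := exists_div q
  rcases le_total 0 a with h | h
  · exact Or.inl ⟨a, b, h, hb, rfl⟩
  · exact Or.inr ⟨-a, b, by simpa using h, hb, by simp [neg_div]⟩⟩

/-- The order of the fraction field: `p ≤ q` iff `q - p` is a nonnegative fraction. -/
noncomputable instance : LinearOrder (FracM M) :=
  haveI : DecidablePred (· ∈ cone M) := Classical.decPred _
  LinearOrder.mkOfAddGroupCone (cone M)

instance : IsStrictOrderedRing (FracM M) :=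
  haveI : IsOrderedRing (FracM M) := IsOrderedRing.mkOfCone (cone M)
  inferInstance

variable (M) in
/-- The inclusion of `-M ∪ M` in its fraction field. -/
noncomputable abbrev ι : MInt M →+* FracM M := algebraMap (MInt M) (FracM M)

theorem ι_nonneg {a : MInt M} (h : 0 ≤ a) : 0 ≤ ι M a := by
  show ι M a - 0 ∈ cone M
  exact ⟨a, 1, h, zero_lt_one, by simp⟩

theorem ι_lt {a b : MInt M} : ι M a < ι M b ↔ a < b := by
  have hm : Monotone (ι M) := fun a b h => by
    have := ι_nonneg (sub_nonneg.2 h)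
    rw [map_sub] at this
    exact sub_nonneg.1 this
  exact (hm.strictMono_of_injective (FaithfulSMul.algebraMap_injective _ _)).lt_iff_lt

end FracM

end Int

/-! ### Sequences in an ordered field indexed by a linear order -/

section Seq

set_option linter.unusedSectionVars false

variable {I : Type*} [LinearOrder I]
  {F : Type*} [Field F] [LinearOrder F] [IsStrictOrderedRing F]

/-- Auxiliary: Cauchy sequences. -/
def Cau (g : I → F) : Prop := ∀ ε > 0, ∃ n, ∀ k₁ > n, ∀ k₂ > n, |g k₁ - g k₂| < ε

/-- Auxiliary: null sequences. -/
def Nul (g : I → F) : Prop := ∀ ε > 0, ∃ n, ∀ k > n, |g k| < ε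

/-- Auxiliary: eventually bounded below by a positive constant. -/
def Pos (g : I → F) : Prop := ∃ ε > 0, ∃ n, ∀ k > n, ε < g k

variable {g h : I → F}

theorem Cau.const [Nonempty I] (c : F) : Cau (fun _ : I => c) := fun ε hε =>
  ⟨Classical.arbitrary I, fun _ _ _ _ => by simpa using hε⟩

theorem Cau.neg (hg : Cau g) : Cau (-g) := fun ε hε => by
  obtain ⟨n, hn⟩ := hg ε hε
  refine ⟨n, fun a ha b hb => ?_⟩
  have := hn b hb a ha
  simpa [add_comm, sub_eq_add_neg] using this

theorem Cau.add (hg : Cau g) (hh : Cau h) : Cau (g + h) := fun ε hε => by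
  obtain ⟨n, hn⟩ := hg (ε / 2) (half_pos hε)
  obtain ⟨m, hm⟩ := hh (ε / 2) (half_pos hε)
  refine ⟨max n m, fun a ha b hb => ?_⟩
  have h1 := abs_lt.1 (hn a (lt_of_le_of_lt (le_max_left _ _) ha) b
    (lt_of_le_of_lt (le_max_left _ _) hb))
  have h2 := abs_lt.1 (hm a (lt_of_le_of_lt (le_max_right _ _) ha) b
    (lt_of_le_of_lt (le_max_right _ _) hb))
  simp only [Pi.add_apply, abs_lt]
  constructor <;> linarith [h1.1, h1.2, h2.1, h2.2]

theorem Nul.neg (hg : Nul g) : Nul (-g) := fun ε hε => by simpa using hg ε hε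

theorem Nul.add (hg : Nul g) (hh : Nul h) : Nul (g + h) := fun ε hε => by
  obtain ⟨n, hn⟩ := hg (ε / 2) (half_pos hε)
  obtain ⟨m, hm⟩ := hh (ε / 2) (half_pos hε)
  refine ⟨max n m, fun a ha => ?_⟩
  have h1 := abs_lt.1 (hn a (lt_of_le_of_lt (le_max_left _ _) ha))
  have h2 := abs_lt.1 (hm a (lt_of_le_of_lt (le_max_right _ _) ha))
  simp only [Pi.add_apply, abs_lt]
  constructor <;> linarith [h1.1, h1.2, h2.1, h2.2]

variable [NoMaxOrder I]

theorem Cau.bounded (hg : Cau g) : ∃ B > 0, ∃ n, ∀ k > n, |g k| < B := by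
  obtain ⟨n, hn⟩ := hg 1 one_pos
  obtain ⟨k, hk⟩ := exists_gt n
  refine ⟨|g k| + 1, by positivity, n, fun a ha => ?_⟩
  have h1 := hn a ha k hk
  have h2 := abs_add_le (g a - g k) (g k)
  simp only [sub_add_cancel] at h2
  linarith

theorem Nul.mul (hg : Nul g) (hh : Cau h) : Nul (g * h) := fun ε hε => by
  obtain ⟨B, hB, m, hm⟩ := hh.bounded
  obtain ⟨n, hn⟩ := hg (ε / B) (div_pos hε hB)
  refine ⟨max n m, fun a ha => ?_⟩
  have h1 := hn a (lt_of_le_of_lt (le_max_left _ _) ha)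
  have h2 := hm a (lt_of_le_of_lt (le_max_right _ _) ha)
  rw [Pi.mul_apply, abs_mul]
  calc |g a| * |h a| ≤ |g a| * B := by gcongr
    _ < ε / B * B := by gcongr
    _ = ε := div_mul_cancel₀ _ hB.ne'

theorem Cau.mul (hg : Cau g) (hh : Cau h) : Cau (g * h) := fun ε hε => by
  obtain ⟨B, hB, m, hm⟩ := hg.bounded
  obtain ⟨C, hC, m', hm'⟩ := hh.bounded
  obtain ⟨n, hn⟩ := hg (ε / 2 / C) (div_pos (half_pos hε) hC)
  obtain ⟨n', hn'⟩ := hh (ε / 2 / B) (div_pos (half_pos hε) hB)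
  refine ⟨max (max m m') (max n n'), fun a ha b hb => ?_⟩
  simp only [gt_iff_lt, max_lt_iff] at ha hb
  have e : (g * h) a - (g * h) b = (g a - g b) * h a + g b * (h a - h b) := by
    simp only [Pi.mul_apply]; ring
  have h1 : |g a - g b| * |h a| < ε / 2 := by
    calc |g a - g b| * |h a| ≤ |g a - g b| * C := by gcongr; exact (hm' a ha.1.2).le
      _ < ε / 2 / C * C := by gcongr; exact hn a ha.2.1 b hb.2.1
      _ = ε / 2 := div_mul_cancel₀ _ hC.ne'
  have h2 : |g b| * |h a - h b| < ε / 2 := by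
    calc |g b| * |h a - h b| ≤ B * |h a - h b| := by gcongr; exact (hm b hb.1.1).le
      _ < B * (ε / 2 / B) := by gcongr; exact hn' a ha.2.2 b hb.2.2
      _ = ε / 2 := mul_div_cancel₀ _ hB.ne'
  rw [e]
  calc _ ≤ |(g a - g b) * h a| + |g b * (h a - h b)| := abs_add_le _ _
    _ < ε := by rw [abs_mul, abs_mul]; linarith

theorem Cau.trichotomy (hg : Cau g) : Nul g ∨ Pos g ∨ Pos (-g) := by
  by_cases h0 : Nul g
  · exact Or.inl h0
  · right
    simp only [Nul, not_forall, not_exists] at h0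
    obtain ⟨ε, hε, h0⟩ := h0
    obtain ⟨n, hn⟩ := hg (ε / 2) (half_pos hε)
    obtain ⟨k, hk, hk'⟩ := h0 n
    rw [not_lt, le_abs] at hk'
    rcases hk' with h1 | h1
    · refine Or.inl ⟨ε / 4, by positivity, n, fun a ha => ?_⟩
      have := (abs_lt.1 (hn a ha k hk)).1
      linarith
    · refine Or.inr ⟨ε / 4, by positivity, n, fun a ha => ?_⟩
      have := (abs_lt.1 (hn a ha k hk)).2
      simp only [Pi.neg_apply]
      linarith

theorem Pos.add (hg : Pos g) (hh : Pos h) : Pos (g + h) := by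
  obtain ⟨ε, hε, n, hn⟩ := hg
  obtain ⟨δ, hδ, m, hm⟩ := hh
  refine ⟨ε + δ, by positivity, max n m, fun a ha => ?_⟩
  exact add_lt_add (hn a (lt_of_le_of_lt (le_max_left _ _) ha))
    (hm a (lt_of_le_of_lt (le_max_right _ _) ha))

theorem Pos.mul (hg : Pos g) (hh : Pos h) : Pos (g * h) := by
  obtain ⟨ε, hε, n, hn⟩ := hg
  obtain ⟨δ, hδ, m, hm⟩ := hh
  refine ⟨ε * δ, by positivity, max n m, fun a ha => ?_⟩
  exact mul_lt_mul'' (hn a (lt_of_le_of_lt (le_max_left _ _) ha))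
    (hm a (lt_of_le_of_lt (le_max_right _ _) ha)) hε.le hδ.le

theorem Pos.add_nul (hg : Pos g) (hh : Nul h) : Pos (g + h) := by
  obtain ⟨ε, hε, n, hn⟩ := hg
  obtain ⟨m, hm⟩ := hh (ε / 2) (half_pos hε)
  refine ⟨ε / 2, by positivity, max n m, fun a ha => ?_⟩
  have h1 := hn a (lt_of_le_of_lt (le_max_left _ _) ha)
  have h2 := (abs_lt.1 (hm a (lt_of_le_of_lt (le_max_right _ _) ha))).1
  simp only [Pi.add_apply]
  linarith

theorem Pos.not_nul (hg : Pos g) : ¬ Nul g := fun hn => by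
  obtain ⟨ε, hε, n, hn'⟩ := hg.add_nul hn.neg
  obtain ⟨k, hk⟩ := exists_gt n
  have := hn' k hk
  simp only [Pi.add_apply, Pi.neg_apply, add_neg_cancel] at this
  exact lt_asymm hε this

theorem Cau.away (hg : Cau g) (h0 : ¬ Nul g) : ∃ ε > 0, ∃ n, ∀ k > n, ε < |g k| := by
  rcases hg.trichotomy with h | ⟨ε, hε, n, hn⟩ | ⟨ε, hε, n, hn⟩
  · exact absurd h h0
  · exact ⟨ε, hε, n, fun k hk => (hn k hk).trans_le (le_abs_self _)⟩
  · exact ⟨ε, hε, n, fun k hk => (hn k hk).trans_le (neg_le_abs _)⟩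

theorem Cau.inv (hg : Cau g) (h0 : ¬ Nul g) : Cau (g⁻¹) := fun δ hδ => by
  obtain ⟨ε, hε, n, hn⟩ := hg.away h0
  obtain ⟨m, hm⟩ := hg (δ * (ε * ε)) (by positivity)
  refine ⟨max n m, fun a ha b hb => ?_⟩
  simp only [gt_iff_lt, max_lt_iff] at ha hb
  have ha1 := hn a ha.1
  have hb1 := hn b hb.1
  have ha0 : g a ≠ 0 := abs_pos.1 (hε.trans ha1)
  have hb0 : g b ≠ 0 := abs_pos.1 (hε.trans hb1)
  have e : (g⁻¹) a - (g⁻¹) b = (g b - g a) / (g a * g b) := by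
    simp only [Pi.inv_apply]; field_simp
  rw [e, abs_div, abs_mul, div_lt_iff₀ (by positivity)]
  calc |g b - g a| < δ * (ε * ε) := hm b hb.2 a ha.2
    _ ≤ δ * (|g a| * |g b|) := by gcongr

theorem Cau.mul_inv (hg : Cau g) (h0 : ¬ Nul g) : Nul (g * g⁻¹ - 1) := fun δ hδ => by
  obtain ⟨ε, hε, n, hn⟩ := hg.away h0
  refine ⟨n, fun a ha => ?_⟩
  have ha0 : g a ≠ 0 := abs_pos.1 (hε.trans (hn a ha))
  simpa [ha0] using hδ

end Seq

/-! ### Definable reals over a model of true arithmetic -/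

section Reals

set_option linter.unusedSectionVars false

variable (M : Type u) [LPA.Structure M] [M ⊨ ThNat]

open MInt FracM

/-- A pre-real over `M`: a function `i ↦ (num i, den i)` from `M` to `(-M ∪ M) × (M \ {0})` whose
graph is definable in `M` with parameters. As the first coordinate ranges over `-M ∪ M`, the graph
is given by two formulas in three variables, one for the values in `M` and one for those in `-M`. -/
structure PreReal where
  num : M → MInt M
  den : M → M
  den_ne : ∀ i, den i ≠ 0
  definable_pos : (Set.univ : Set M).Definable LPA
    {v : Fin 3 → M | num (v 0) = of M (v 1) ∧ den (v 0) = v 2}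
  definable_neg : (Set.univ : Set M).Definable LPA
    {v : Fin 3 → M | num (v 0) = -of M (v 1) ∧ den (v 0) = v 2}

variable {M}

namespace PreReal

/-- For every `m` there is `n` such that `m (a₁ / b₁ - a₂ / b₂) < 1` for all entries `a₁ / b₁` and
`a₂ / b₂` with indices above `n`, the inequality being written without denominators. -/
def Convergent (x : PreReal M) : Prop :=
  ∀ m : M, ∃ n : M, ∀ k₁ > n, ∀ k₂ > n,
    of M m * (x.num k₁ * of M (x.den k₂) - x.num k₂ * of M (x.den k₁)) <
      of M (x.den k₁) * of M (x.den k₂)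

/-- For every `m` there is `n` such that `m |a / b - c / d| < 1` for the entries `a / b` of `x` and
`c / d` of `y` with the same index above `n`. -/
def Equivalent (x y : PreReal M) : Prop :=
  ∀ m : M, ∃ n : M, ∀ k > n,
    of M m * |x.num k * of M (y.den k) - y.num k * of M (x.den k)| <
      of M (x.den k) * of M (y.den k)

/-- For some `m` and `k`, `m (a / b) + 1 < m (c / d)` for the entries `a / b` of `x` and `c / d` of
`y` with the same index above `k`. -/
def Less (x y : PreReal M) : Prop :=
  ∃ m k : M, ∀ l > k,
    of M m * (x.num l * of M (y.den l)) + of M (x.den l) * of M (y.den l) <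
      of M m * (y.num l * of M (x.den l))

/-- The sequence of fractions of a pre-real. -/
noncomputable def seq (x : PreReal M) (i : M) : FracM M :=
  ι M (x.num i) / ι M (of M (x.den i))

end PreReal

/-- The image of an element of `M` in the fraction field. -/
noncomputable abbrev cst (m : M) : FracM M := ι M (of M m)

theorem cst_nonneg (m : M) : 0 ≤ cst m := ι_nonneg (of_nonneg m)

theorem cst_pos {m : M} (h : m ≠ 0) : 0 < cst m := by
  rw [← map_zero (ι M), ι_lt, of_pos]
  exact lt_of_le_of_ne (zero_le' m) h.symm

instance (priority := 50) instNoMaxOrder : NoMaxOrder M := ⟨fun a => ⟨a + 1, lt_add_one a⟩⟩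

instance (priority := 50) instNoZeroDivisors : NoZeroDivisors M := ⟨fun {a b} h => by
  by_contra hn
  rw [not_or] at hn
  have := mul_pos (lt_of_le_of_ne (zero_le' a) (Ne.symm hn.1))
    (lt_of_le_of_ne (zero_le' b) (Ne.symm hn.2))
  exact this.ne' h⟩

theorem exists_cst {ε : FracM M} (hε : 0 < ε) : ∃ m : M, 0 < cst m ∧ 1 ≤ cst m * ε := by
  obtain ⟨a, b, hb, rfl⟩ := exists_div ε
  have hb' : 0 < ι M b := by rwa [← map_zero (ι M), ι_lt]
  have ha : 0 < a := by
    have := (div_pos_iff_of_pos_right hb').1 hε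
    rwa [← map_zero (ι M), ι_lt] at this
  obtain ⟨b, rfl⟩ := exists_of_nonneg hb.le
  obtain ⟨a, rfl⟩ := exists_of_nonneg ha.le
  refine ⟨b, hb', ?_⟩
  rw [mul_div_cancel₀ _ hb'.ne']
  have h1 : (1 : M) ≤ a := one_le_of_ne (of_pos.1 ha).ne'
  have : of M 1 ≤ of M a := by
    rcases h1.lt_or_eq with h | rfl
    · exact (of_lt.2 h).le
    · exact le_rfl
  have := ι_nonneg (sub_nonneg.2 this)
  rw [map_sub, of_one, map_one] at this
  exact sub_nonneg.1 this

theorem small_of_cst {m : M} {δ : FracM M} (h : |δ| < 1 / (cst m + 1)) : cst m * |δ| < 1 := by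
  have hm := cst_nonneg m
  rw [lt_div_iff₀ (by positivity)] at h
  have := abs_nonneg δ
  nlinarith

theorem lt_of_cst {m : M} {ε δ : FracM M} (hm : 0 < cst m) (h : 1 ≤ cst m * ε)
    (h' : cst m * δ < 1) : δ < ε :=
  lt_of_mul_lt_mul_left (h'.trans_le h) hm.le

namespace PreReal

variable (x y : PreReal M)

theorem den_pos (i : M) : 0 < cst (x.den i) := cst_pos (x.den_ne i)

theorem sub_seq (i j : M) : x.seq i - y.seq j =
    ι M (x.num i * of M (y.den j) - y.num j * of M (x.den i)) /
      ι M (of M (x.den i) * of M (y.den j)) := by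
  have h1 := (x.den_pos i).ne'
  have h2 := (y.den_pos j).ne'
  rw [seq, seq, div_sub_div _ _ h1 h2, map_sub, map_mul, map_mul, map_mul]
  ring

theorem den_mul_pos (i j : M) : 0 < ι M (of M (x.den i) * of M (y.den j)) := by
  rw [map_mul]
  exact mul_pos (x.den_pos i) (y.den_pos j)

theorem convergent_iff : x.Convergent ↔ Cau x.seq := by
  have key : ∀ m i j : M, of M m * (x.num i * of M (x.den j) - x.num j * of M (x.den i)) <
      of M (x.den i) * of M (x.den j) ↔ cst m * (x.seq i - x.seq j) < 1 := by
    intro m i j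
    rw [sub_seq, ← mul_div_assoc, div_lt_one (x.den_mul_pos x i j), ← map_mul (ι M), ι_lt]
  simp only [Convergent, key]
  constructor
  · intro h ε hε
    obtain ⟨m, hm, hm'⟩ := exists_cst hε
    obtain ⟨n, hn⟩ := h m
    refine ⟨n, fun k₁ h₁ k₂ h₂ => abs_sub_lt_iff.2 ⟨?_, ?_⟩⟩
    · exact lt_of_cst hm hm' (hn k₁ h₁ k₂ h₂)
    · exact lt_of_cst hm hm' (hn k₂ h₂ k₁ h₁)
  · intro h m
    have hm := cst_nonneg m
    obtain ⟨n, hn⟩ := h (1 / (cst m + 1)) (by positivity)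
    refine ⟨n, fun k₁ h₁ k₂ h₂ => ?_⟩
    exact (mul_le_mul_of_nonneg_left (le_abs_self _) hm).trans_lt (small_of_cst (hn k₁ h₁ k₂ h₂))

theorem ι_abs (a : MInt M) : ι M |a| = |ι M a| := by
  rcases le_total 0 a with h | h
  · rw [abs_of_nonneg h, abs_of_nonneg (ι_nonneg h)]
  · have := ι_nonneg (neg_nonneg.2 h)
    rw [map_neg] at this
    rw [abs_of_nonpos h, abs_of_nonpos (neg_nonneg.1 this), map_neg]

theorem equivalent_iff : x.Equivalent y ↔ Nul (x.seq - y.seq) := by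
  have key : ∀ m k : M, of M m * |x.num k * of M (y.den k) - y.num k * of M (x.den k)| <
      of M (x.den k) * of M (y.den k) ↔ cst m * |x.seq k - y.seq k| < 1 := by
    intro m k
    rw [sub_seq, abs_div, abs_of_pos (x.den_mul_pos y k k), ← mul_div_assoc,
      div_lt_one (x.den_mul_pos y k k), ← ι_abs, ← map_mul (ι M), ι_lt]
  simp only [Equivalent, key]
  constructor
  · intro h ε hε
    obtain ⟨m, hm, hm'⟩ := exists_cst hε
    obtain ⟨n, hn⟩ := h m
    exact ⟨n, fun k hk => lt_of_cst hm hm' (hn k hk)⟩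
  · intro h m
    have hm := cst_nonneg m
    obtain ⟨n, hn⟩ := h (1 / (cst m + 1)) (by positivity)
    exact ⟨n, fun k hk => small_of_cst (hn k hk)⟩

theorem less_iff : x.Less y ↔ Pos (y.seq - x.seq) := by
  have key : ∀ m l : M, of M m * (x.num l * of M (y.den l)) + of M (x.den l) * of M (y.den l) <
      of M m * (y.num l * of M (x.den l)) ↔ 1 < cst m * (y.seq l - x.seq l) := by
    intro m l
    rw [sub_seq, ← mul_div_assoc, one_lt_div (y.den_mul_pos x l l), ← map_mul (ι M), ι_lt, mul_sub,
      lt_sub_iff_add_lt, add_comm, mul_comm (of M (x.den l))]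
  simp only [Less, key]
  constructor
  · rintro ⟨m, k, h⟩
    have hm : 0 < cst m := by
      apply cst_pos
      rintro rfl
      obtain ⟨l, hl⟩ := exists_gt k
      have := h l hl
      simp only [cst, map_zero, zero_mul] at this
      exact absurd this (not_lt.2 zero_le_one)
    refine ⟨1 / cst m, by positivity, k, fun l hl => ?_⟩
    rw [div_lt_iff₀' hm]
    exact h l hl
  · rintro ⟨ε, hε, n, hn⟩
    obtain ⟨m, hm, hm'⟩ := exists_cst hε
    exact ⟨m, n, fun l hl => hm'.trans_lt (mul_lt_mul_of_pos_left (hn l hl) hm)⟩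

end PreReal

/-! #### Definability -/

/-- Auxiliary: a unary function on `M` that is definable with parameters. -/
def DefFun (f : M → M) : Prop :=
  (Set.univ : Set M).DefinableFun LPA (fun v : Fin 1 → M => f (v 0))

theorem DefFun.at {f : M → M} (hf : DefFun f) {α : Type} (i : α) :
    (Set.univ : Set M).DefinableFun LPA (fun v : α → M => f (v i)) := by
  have := Set.DefinableFun.comp (L := LPA) (A := (Set.univ : Set M))
    (g := fun (v : α → M) (_ : Fin 1) => v i) (fun _ => Set.DefinableFun.proj (L := LPA)) hf
  exact this

section

variable {α : Type} {f g : (α → M) → M}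

theorem defAdd (hf : (Set.univ : Set M).DefinableFun LPA f)
    (hg : (Set.univ : Set M).DefinableFun LPA g) :
    (Set.univ : Set M).DefinableFun LPA (fun v => f v + g v) :=
  Set.DefinableFun.comp (L := LPA) (A := (Set.univ : Set M)) (g := fun v => ![f v, g v])
    (fun i => by fin_cases i <;> assumption)
    (Set.DefinableFun.of_empty (Set.DefinableFun.fun_symbol (L := LPA) PAFunc.add))

theorem defMul (hf : (Set.univ : Set M).DefinableFun LPA f)
    (hg : (Set.univ : Set M).DefinableFun LPA g) :
    (Set.univ : Set M).DefinableFun LPA (fun v => f v * g v) :=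
  Set.DefinableFun.comp (L := LPA) (A := (Set.univ : Set M)) (g := fun v => ![f v, g v])
    (fun i => by fin_cases i <;> assumption)
    (Set.DefinableFun.of_empty (Set.DefinableFun.fun_symbol (L := LPA) PAFunc.mul))

end

theorem DefFun.const (c : M) : DefFun (fun _ : M => c) :=
  LPA.definableFun_const _ (Set.mem_univ c)

theorem DefFun.add {f g : M → M} (hf : DefFun f) (hg : DefFun g) : DefFun (fun i => f i + g i) :=
  defAdd hf hg

theorem DefFun.mul {f g : M → M} (hf : DefFun f) (hg : DefFun g) : DefFun (fun i => f i * g i) :=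
  defMul hf hg

open Classical in
theorem DefFun.ite {e f g : M → M} (he : DefFun e) (hf : DefFun f) (hg : DefFun g) :
    DefFun (fun i => if e i = 0 then f i else g i) :=
  Set.DefinableFun.ite (p := fun v : Fin 1 → M => e (v 0) = 0)
    (Set.DefinableFun.ofPred_eq_const he (Set.mem_univ 0)) hf hg

theorem definable_pos_of {p n d : M → M} (hp : DefFun p) (hn : DefFun n) (hd : DefFun d)
    {num : M → MInt M} (h : ∀ i, num i = of M (p i) - of M (n i)) :
    (Set.univ : Set M).Definable LPA
      {v : Fin 3 → M | num (v 0) = of M (v 1) ∧ d (v 0) = v 2} := by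
  have h1 : ∀ v : Fin 3 → M, num (v 0) = of M (v 1) ↔ p (v 0) = v 1 + n (v 0) := fun v => by
    rw [h, sub_eq_iff_eq_add, ← map_add, of_inj]
  simp only [h1]
  exact (Set.DefinableFun.ofPred_eq (hp.at 0)
    (defAdd (Set.DefinableFun.proj (L := LPA)) (hn.at 0))).inter
    (Set.DefinableFun.ofPred_eq (hd.at 0) (Set.DefinableFun.proj (L := LPA)))

theorem definable_neg_of {p n d : M → M} (hp : DefFun p) (hn : DefFun n) (hd : DefFun d)
    {num : M → MInt M} (h : ∀ i, num i = of M (p i) - of M (n i)) :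
    (Set.univ : Set M).Definable LPA
      {v : Fin 3 → M | num (v 0) = -of M (v 1) ∧ d (v 0) = v 2} := by
  have := definable_pos_of hn hp hd (num := fun i => -num i) (fun i => by rw [h, neg_sub])
  simpa only [neg_eq_iff_eq_neg] using this

namespace MInt

open Classical in
/-- The `M`-part of an element of `-M ∪ M`. -/
noncomputable def part (z : MInt M) : M := if h : ∃ a, z = of M a then h.choose else 0

theorem part_of (a : M) : part (of M a) = a := by
  have h : ∃ b, of M a = of M b := ⟨a, rfl⟩
  rw [part, dif_pos h]
  exact (of_inj.1 h.choose_spec).symm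

theorem part_neg_of (a : M) : part (-of M a) = 0 := by
  by_cases h : ∃ b, -of M a = of M b
  · rw [part, dif_pos h]
    have h1 := h.choose_spec
    rw [neg_eq_iff_add_eq_zero, ← map_add, ← map_zero (of M), of_inj] at h1
    exact le_antisymm (h1 ▸ le_add_of_nonneg_left (zero_le' a)) (zero_le' _)
  · rw [part, dif_neg h]

theorem eq_part_sub (z : MInt M) : z = of M (part z) - of M (part (-z)) := by
  obtain ⟨a, rfl | rfl⟩ := eq_or_eq_neg z
  · rw [part_of, part_neg_of]; simp
  · rw [part_neg_of, neg_neg, part_of]; simp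

end MInt

namespace PreReal

theorem defPart (x : PreReal M) : DefFun (fun i => MInt.part (x.num i)) := by
  have h1 := (x.definable_pos.preimage_comp (![Sum.inl (some 0), Sum.inl none, Sum.inr 0] :
    Fin 3 → Option (Fin 1) ⊕ Fin 1)).exists_of_finite
  have h2 := (x.definable_neg.preimage_comp (![Sum.inl (some 0), Sum.inr 0, Sum.inr 1] :
    Fin 3 → Option (Fin 1) ⊕ Fin 2)).exists_of_finite
  have h3 : (Set.univ : Set M).Definable LPA {w : Option (Fin 1) → M | w none = 0} :=
    Set.DefinableFun.ofPred_eq_const (Set.DefinableFun.proj (L := LPA)) (Set.mem_univ 0)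
  have h4 := h1.union (h3.inter h2)
  unfold DefFun Set.DefinableFun
  convert h4 using 1
  ext w
  simp [Function.tupleGraph]
  constructor
  · rintro h
    obtain ⟨a, ha | ha⟩ := eq_or_eq_neg (x.num (w (some 0)))
    · rw [ha, part_of] at h
      exact Or.inl ⟨by rw [ha, h], fun _ => _, rfl⟩
    · rw [ha, part_neg_of] at h
      exact Or.inr ⟨h.symm, ![a, x.den (w (some 0))], ha, rfl⟩
  · rintro (⟨h, -⟩ | ⟨h, u, h', -⟩)
    · rw [h, part_of]
    · rw [h, h', part_neg_of]

theorem defDen (x : PreReal M) : DefFun x.den := by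
  have h1 := (x.definable_pos.preimage_comp (![Sum.inl (some 0), Sum.inr 0, Sum.inl none] :
    Fin 3 → Option (Fin 1) ⊕ Fin 1)).exists_of_finite
  have h2 := (x.definable_neg.preimage_comp (![Sum.inl (some 0), Sum.inr 0, Sum.inl none] :
    Fin 3 → Option (Fin 1) ⊕ Fin 1)).exists_of_finite
  have h4 := h1.union h2
  unfold DefFun Set.DefinableFun
  convert h4 using 1
  ext w
  simp [Function.tupleGraph]
  constructor
  · rintro h
    obtain ⟨a, ha | ha⟩ := eq_or_eq_neg (x.num (w (some 0)))
    · exact Or.inl ⟨⟨fun _ => a, ha⟩, h⟩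
    · exact Or.inr ⟨⟨fun _ => a, ha⟩, h⟩
  · rintro (⟨-, h⟩ | ⟨-, h⟩) <;> exact h

theorem defPartNeg (x : PreReal M) : DefFun (fun i => MInt.part (-x.num i)) :=
  defPart
    { num := fun i => -x.num i
      den := x.den
      den_ne := x.den_ne
      definable_pos := by simpa only [neg_eq_iff_eq_neg] using x.definable_neg
      definable_neg := by simpa only [neg_inj] using x.definable_pos }

variable (x y : PreReal M)

/-- A constant pre-real. -/
noncomputable def const (c : M) : PreReal M where
  num _ := of M c
  den _ := 1
  den_ne _ := one_ne_zero
  definable_pos := definable_pos_of (.const c) (.const 0) (.const 1)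
    (num := fun _ => of M c) (fun _ => by simp)
  definable_neg := definable_neg_of (.const c) (.const 0) (.const 1)
    (num := fun _ => of M c) (fun _ => by simp)

/-- Termwise sum: `a / b + c / d = (a d + b c) / (b d)`. -/
noncomputable def add : PreReal M where
  num i := x.num i * of M (y.den i) + of M (x.den i) * y.num i
  den i := x.den i * y.den i
  den_ne i := mul_ne_zero (x.den_ne i) (y.den_ne i)
  definable_pos := definable_pos_of
    ((x.defPart.mul y.defDen).add (x.defDen.mul y.defPart))
    ((x.defPartNeg.mul y.defDen).add (x.defDen.mul y.defPartNeg)) (x.defDen.mul y.defDen)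
    (num := fun i => x.num i * of M (y.den i) + of M (x.den i) * y.num i) (fun i => by
      rw [map_add, map_add, of_mul, of_mul, of_mul, of_mul]
      linear_combination (of M (y.den i)) * eq_part_sub (x.num i) +
        (of M (x.den i)) * eq_part_sub (y.num i))
  definable_neg := definable_neg_of
    ((x.defPart.mul y.defDen).add (x.defDen.mul y.defPart))
    ((x.defPartNeg.mul y.defDen).add (x.defDen.mul y.defPartNeg)) (x.defDen.mul y.defDen)
    (num := fun i => x.num i * of M (y.den i) + of M (x.den i) * y.num i) (fun i => by
      rw [map_add, map_add, of_mul, of_mul, of_mul, of_mul]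
      linear_combination (of M (y.den i)) * eq_part_sub (x.num i) +
        (of M (x.den i)) * eq_part_sub (y.num i))

theorem mul_eq (a b : MInt M) : a * b =
    of M (part a * part b + part (-a) * part (-b)) -
      of M (part a * part (-b) + part (-a) * part b) := by
  conv_lhs => rw [eq_part_sub a, eq_part_sub b]
  simp only [map_add, of_mul]
  ring

/-- Termwise product: `(a / b) (c / d) = (a c) / (b d)`. -/
noncomputable def mul : PreReal M where
  num i := x.num i * y.num i
  den i := x.den i * y.den i
  den_ne i := mul_ne_zero (x.den_ne i) (y.den_ne i)
  definable_pos := definable_pos_of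
    ((x.defPart.mul y.defPart).add (x.defPartNeg.mul y.defPartNeg))
    ((x.defPart.mul y.defPartNeg).add (x.defPartNeg.mul y.defPart))
    (x.defDen.mul y.defDen) (num := fun i => x.num i * y.num i) (fun _ => mul_eq _ _)
  definable_neg := definable_neg_of
    ((x.defPart.mul y.defPart).add (x.defPartNeg.mul y.defPartNeg))
    ((x.defPart.mul y.defPartNeg).add (x.defPartNeg.mul y.defPart))
    (x.defDen.mul y.defDen) (num := fun i => x.num i * y.num i) (fun _ => mul_eq _ _)

/-- Termwise negation. -/
noncomputable def neg : PreReal M where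
  num i := -x.num i
  den := x.den
  den_ne := x.den_ne
  definable_pos := by simpa only [neg_eq_iff_eq_neg] using x.definable_neg
  definable_neg := by simpa only [neg_inj] using x.definable_pos

open Classical in
/-- Auxiliary: the denominator of the termwise inverse. -/
noncomputable def invDen (z : MInt M) : M :=
  if part z + part (-z) = 0 then 1 else part z + part (-z)

open Classical in
/-- Auxiliary: the numerator of the termwise inverse. -/
noncomputable def invNum (z : MInt M) (d : M) : MInt M :=
  of M (if part z = 0 then 0 else d) - of M (if part (-z) = 0 then 0 else d)

/-- Termwise inverse, with the value `0 / 1` at the terms that are zero. -/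
noncomputable def inv : PreReal M where
  num i := invNum (x.num i) (x.den i)
  den i := invDen (x.num i)
  den_ne i := by
    unfold invDen
    split_ifs with h
    · exact one_ne_zero
    · exact h
  definable_pos := definable_pos_of
    (x.defPart.ite (.const 0) x.defDen) (x.defPartNeg.ite (.const 0) x.defDen)
    ((x.defPart.add x.defPartNeg).ite (.const 1) (x.defPart.add x.defPartNeg)) (fun _ => rfl)
  definable_neg := definable_neg_of
    (x.defPart.ite (.const 0) x.defDen) (x.defPartNeg.ite (.const 0) x.defDen)
    ((x.defPart.add x.defPartNeg).ite (.const 1) (x.defPart.add x.defPartNeg)) (fun _ => rfl)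

theorem seq_const (c : M) : (const c).seq = fun _ => cst c := by
  funext i
  simp [seq, const, of_one]

theorem seq_add : (x.add y).seq = x.seq + y.seq := by
  funext i
  rw [Pi.add_apply, seq, seq, seq, div_add_div _ _ (x.den_pos i).ne' (y.den_pos i).ne']
  simp [add, of_mul]

theorem seq_mul : (x.mul y).seq = x.seq * y.seq := by
  funext i
  rw [Pi.mul_apply, seq, seq, seq, div_mul_div_comm]
  simp [mul, of_mul]

theorem seq_neg : x.neg.seq = -x.seq := by
  funext i
  rw [Pi.neg_apply, seq, seq, ← neg_div]
  simp [neg]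

theorem seq_inv : x.inv.seq = x.seq⁻¹ := by
  funext i
  rw [Pi.inv_apply, seq, seq, inv_div]
  show ι M (invNum (x.num i) (x.den i)) / cst (invDen (x.num i)) = _
  unfold invNum invDen
  obtain ⟨a, ha | ha⟩ := eq_or_eq_neg (x.num i)
  · rw [ha, part_neg_of, part_of]
    by_cases h : a = 0 <;> simp [h]
  · rw [ha, neg_neg, part_neg_of, part_of]
    by_cases h : a = 0 <;> simp [h, neg_div, div_neg]

end PreReal

/-! #### The ordered field `K_M` -/

variable (M) in
/-- An `M`-real is a convergent pre-real over `M`. -/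
def MReal : Type u := {x : PreReal M // x.Convergent}

namespace MReal

variable (x y z : MReal M)

/-- The sequence of fractions of an `M`-real. -/
noncomputable def seq : M → FracM M := x.1.seq

theorem cau : Cau x.seq := x.1.convergent_iff.1 x.2

/-- Equivalence of `M`-reals. -/
instance setoid : Setoid (MReal M) where
  r x y := x.1.Equivalent y.1
  iseqv :=
    { refl := fun x => by
        rw [PreReal.equivalent_iff, sub_self]
        exact fun ε hε => ⟨0, fun _ _ => by simpa using hε⟩
      symm := fun {x y} h => by
        rw [PreReal.equivalent_iff] at h ⊢
        simpa using h.neg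
      trans := fun {x y z} h h' => by
        rw [PreReal.equivalent_iff] at h h' ⊢
        simpa using h.add h' }

variable {x y z}

theorem equiv_iff : x ≈ y ↔ Nul (x.seq - y.seq) := x.1.equivalent_iff y.1

theorem equiv_of_seq (h : x.seq = y.seq) : x ≈ y := by
  rw [equiv_iff, h, sub_self]
  exact fun ε hε => ⟨0, fun _ _ => by simpa using hε⟩

/-- The constant `M`-real of an element of `M`. -/
noncomputable def const (c : M) : MReal M :=
  ⟨PreReal.const c, by rw [PreReal.convergent_iff, PreReal.seq_const]; exact Cau.const _⟩

variable (x y)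

noncomputable def add : MReal M :=
  ⟨x.1.add y.1, by rw [PreReal.convergent_iff, PreReal.seq_add]; exact x.cau.add y.cau⟩

noncomputable def mul : MReal M :=
  ⟨x.1.mul y.1, by rw [PreReal.convergent_iff, PreReal.seq_mul]; exact x.cau.mul y.cau⟩

noncomputable def neg : MReal M :=
  ⟨x.1.neg, by rw [PreReal.convergent_iff, PreReal.seq_neg]; exact x.cau.neg⟩

theorem seq_const (c : M) : (const c).seq = fun _ => cst c := PreReal.seq_const c
theorem seq_add : (x.add y).seq = x.seq + y.seq := PreReal.seq_add _ _
theorem seq_mul : (x.mul y).seq = x.seq * y.seq := PreReal.seq_mul _ _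
theorem seq_neg : x.neg.seq = -x.seq := PreReal.seq_neg _

end MReal

variable (M) in
/-- `K_M`: the `M`-reals modulo equivalence. -/
def KM : Type u := Quotient (MReal.setoid (M := M))

namespace KM

open MReal

/-- The class of an `M`-real. -/
def mk (x : MReal M) : KM M := Quotient.mk _ x

theorem mk_eq {x y : MReal M} : mk x = mk y ↔ Nul (x.seq - y.seq) :=
  Quotient.eq.trans equiv_iff

theorem mk_eq_of_seq {x y : MReal M} (h : x.seq = y.seq) : mk x = mk y :=
  Quotient.sound (equiv_of_seq h)

theorem exists_mk (p : KM M) : ∃ x, p = mk x := ⟨p.out, p.out_eq.symm⟩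

noncomputable instance : Zero (KM M) := ⟨mk (const 0)⟩
noncomputable instance : One (KM M) := ⟨mk (const 1)⟩

noncomputable instance : Add (KM M) :=
  ⟨Quotient.map₂ MReal.add fun x x' h y y' h' => by
    rw [equiv_iff] at h h' ⊢
    rw [seq_add, seq_add, add_sub_add_comm]
    exact h.add h'⟩

noncomputable instance : Mul (KM M) :=
  ⟨Quotient.map₂ MReal.mul fun x x' h y y' h' => by
    rw [equiv_iff] at h h' ⊢
    rw [seq_mul, seq_mul]
    have e : x.seq * y.seq - x'.seq * y'.seq =
      (x.seq - x'.seq) * y.seq + (y.seq - y'.seq) * x'.seq := by ring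
    rw [e]
    exact (h.mul y.cau).add (h'.mul x'.cau)⟩

noncomputable instance : Neg (KM M) :=
  ⟨Quotient.map MReal.neg fun x x' h => by
    rw [equiv_iff] at h ⊢
    rw [seq_neg, seq_neg]
    have e : -x.seq - -x'.seq = -(x.seq - x'.seq) := by ring
    rw [e]
    exact h.neg⟩

theorem less_congr {x x' y y' : MReal M} (h : x ≈ x') (h' : y ≈ y') (hl : x.1.Less y.1) :
    x'.1.Less y'.1 := by
  rw [PreReal.less_iff] at hl ⊢
  rw [equiv_iff] at h h'
  have := (hl.add_nul h).add_nul h'.neg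
  have e : y.1.seq - x.1.seq + (x.seq - x'.seq) + -(y.seq - y'.seq) = y'.1.seq - x'.1.seq := by
    simp only [MReal.seq]; ring
  rwa [e] at this

instance : LT (KM M) :=
  ⟨Quotient.lift₂ (fun x y => x.1.Less y.1) fun _ _ _ _ h h' =>
    propext ⟨less_congr h h', less_congr (Setoid.symm h) (Setoid.symm h')⟩⟩

theorem zero_def : (0 : KM M) = mk (const 0) := rfl
theorem one_def : (1 : KM M) = mk (const 1) := rfl
theorem mk_add (x y : MReal M) : mk x + mk y = mk (x.add y) := rfl
theorem mk_mul (x y : MReal M) : mk x * mk y = mk (x.mul y) := rfl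
theorem mk_neg (x : MReal M) : -mk x = mk x.neg := rfl
theorem mk_lt {x y : MReal M} : mk x < mk y ↔ Pos (y.seq - x.seq) := x.1.less_iff y.1

theorem seq_zero : (const (0 : M)).seq = 0 := by
  rw [seq_const]; funext i; simp [cst]

theorem seq_one : (const (1 : M)).seq = 1 := by
  rw [seq_const]; funext i; simp [cst, of_one]

noncomputable instance : CommRing (KM M) where
  add_assoc p q r := by
    obtain ⟨x, rfl⟩ := exists_mk p
    obtain ⟨y, rfl⟩ := exists_mk q
    obtain ⟨z, rfl⟩ := exists_mk r
    exact mk_eq_of_seq (by simp only [seq_add]; ring)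
  zero_add p := by
    obtain ⟨x, rfl⟩ := exists_mk p
    exact mk_eq_of_seq (by simp only [seq_add, seq_zero]; ring)
  add_zero p := by
    obtain ⟨x, rfl⟩ := exists_mk p
    exact mk_eq_of_seq (by simp only [seq_add, seq_zero]; ring)
  add_comm p q := by
    obtain ⟨x, rfl⟩ := exists_mk p
    obtain ⟨y, rfl⟩ := exists_mk q
    exact mk_eq_of_seq (by simp only [seq_add]; ring)
  left_distrib p q r := by
    obtain ⟨x, rfl⟩ := exists_mk p
    obtain ⟨y, rfl⟩ := exists_mk q
    obtain ⟨z, rfl⟩ := exists_mk r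
    exact mk_eq_of_seq (by simp only [seq_add, seq_mul]; ring)
  right_distrib p q r := by
    obtain ⟨x, rfl⟩ := exists_mk p
    obtain ⟨y, rfl⟩ := exists_mk q
    obtain ⟨z, rfl⟩ := exists_mk r
    exact mk_eq_of_seq (by simp only [seq_add, seq_mul]; ring)
  zero_mul p := by
    obtain ⟨x, rfl⟩ := exists_mk p
    exact mk_eq_of_seq (by simp only [seq_mul, seq_zero]; ring)
  mul_zero p := by
    obtain ⟨x, rfl⟩ := exists_mk p
    exact mk_eq_of_seq (by simp only [seq_mul, seq_zero]; ring)
  mul_assoc p q r := by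
    obtain ⟨x, rfl⟩ := exists_mk p
    obtain ⟨y, rfl⟩ := exists_mk q
    obtain ⟨z, rfl⟩ := exists_mk r
    exact mk_eq_of_seq (by simp only [seq_mul]; ring)
  one_mul p := by
    obtain ⟨x, rfl⟩ := exists_mk p
    exact mk_eq_of_seq (by simp only [seq_mul, seq_one]; ring)
  mul_one p := by
    obtain ⟨x, rfl⟩ := exists_mk p
    exact mk_eq_of_seq (by simp only [seq_mul, seq_one]; ring)
  mul_comm p q := by
    obtain ⟨x, rfl⟩ := exists_mk p
    obtain ⟨y, rfl⟩ := exists_mk q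
    exact mk_eq_of_seq (by simp only [seq_mul]; ring)
  neg_add_cancel p := by
    obtain ⟨x, rfl⟩ := exists_mk p
    exact mk_eq_of_seq (by simp only [seq_add, seq_neg, seq_zero]; ring)
  nsmul := nsmulRec
  zsmul := zsmulRec

theorem mk_eq_zero {x : MReal M} : mk x = 0 ↔ Nul x.seq := by
  rw [zero_def, mk_eq, seq_zero, sub_zero]

theorem mk_pos {x : MReal M} : 0 < mk x ↔ Pos x.seq := by
  rw [zero_def, mk_lt, seq_zero, sub_zero]

theorem pos_trichotomy (p : KM M) : p = 0 ∨ 0 < p ∨ 0 < -p := by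
  obtain ⟨x, rfl⟩ := exists_mk p
  rw [mk_eq_zero, mk_neg, mk_pos, mk_pos, seq_neg]
  exact x.cau.trichotomy

theorem lt_iff_sub_pos (p q : KM M) : p < q ↔ 0 < q - p := by
  obtain ⟨x, rfl⟩ := exists_mk p
  obtain ⟨y, rfl⟩ := exists_mk q
  rw [sub_eq_add_neg, mk_neg, mk_add, mk_pos, mk_lt, seq_add, seq_neg, sub_eq_add_neg]

theorem pos_add {p q : KM M} (hp : 0 < p) (hq : 0 < q) : 0 < p + q := by
  obtain ⟨x, rfl⟩ := exists_mk p
  obtain ⟨y, rfl⟩ := exists_mk q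
  rw [mk_pos] at hp hq
  rw [mk_add, mk_pos, seq_add]
  exact hp.add hq

theorem pos_mul {p q : KM M} (hp : 0 < p) (hq : 0 < q) : 0 < p * q := by
  obtain ⟨x, rfl⟩ := exists_mk p
  obtain ⟨y, rfl⟩ := exists_mk q
  rw [mk_pos] at hp hq
  rw [mk_mul, mk_pos, seq_mul]
  exact hp.mul hq

theorem not_zero_pos : ¬ (0 : KM M) < 0 := by
  rw [zero_def, mk_lt, sub_self]
  exact fun h => h.not_nul fun ε hε => ⟨0, fun _ _ => by simpa using hε⟩

theorem lt_trans' {p q r : KM M} (h : p < q) (h' : q < r) : p < r := by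
  rw [lt_iff_sub_pos] at h h' ⊢
  simpa using pos_add h h'

theorem lt_irrefl' (p : KM M) : ¬ p < p := by
  rw [lt_iff_sub_pos, sub_self]
  exact not_zero_pos

/-- The linear order of `K_M`, where `p ≤ q` means `p < q` or `p = q`. -/
noncomputable instance : LinearOrder (KM M) where
  le p q := p < q ∨ p = q
  le_refl p := Or.inr rfl
  le_trans p q r := by
    rintro (h | rfl) (h' | rfl)
    · exact Or.inl (lt_trans' h h')
    · exact Or.inl h
    · exact Or.inl h'
    · exact Or.inr rfl
  lt_iff_le_not_ge p q := by
    constructor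
    · refine fun h => ⟨Or.inl h, ?_⟩
      rintro (h' | rfl)
      · exact lt_irrefl' _ (lt_trans' h h')
      · exact lt_irrefl' _ h
    · rintro ⟨h | rfl, h'⟩
      · exact h
      · exact absurd (Or.inr rfl) h'
  le_antisymm p q := by
    rintro (h | rfl) (h' | h')
    · exact absurd (lt_trans' h h') (lt_irrefl' _)
    · exact h'.symm
    · rfl
    · rfl
  le_total p q := by
    rcases pos_trichotomy (q - p) with h | h | h
    · exact Or.inl (Or.inr (sub_eq_zero.1 h).symm)
    · exact Or.inl (Or.inl ((lt_iff_sub_pos _ _).2 h))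
    · exact Or.inr (Or.inl ((lt_iff_sub_pos _ _).2 (by rwa [neg_sub] at h)))
  toDecidableLE := Classical.decRel _
  toDecidableLT := Classical.decRel _
  toDecidableEq := Classical.decEq _

theorem zero_lt_one' : (0 : KM M) < 1 := by
  rw [one_def, mk_pos, seq_one]
  refine ⟨1 / 2, by norm_num, 0, fun _ _ => ?_⟩
  simp only [Pi.one_apply]
  norm_num

theorem exists_inv {p : KM M} (hp : p ≠ 0) : ∃ q : KM M, p * q = 1 := by
  obtain ⟨x, rfl⟩ := exists_mk p
  rw [Ne, mk_eq_zero] at hp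
  let y : MReal M :=
    ⟨x.1.inv, by rw [PreReal.convergent_iff, PreReal.seq_inv]; exact x.cau.inv hp⟩
  have hy : y.seq = x.seq⁻¹ := PreReal.seq_inv _
  refine ⟨mk y, ?_⟩
  rw [one_def, mk_mul, mk_eq, seq_mul, hy, seq_one]
  exact x.cau.mul_inv hp

noncomputable instance : Field (KM M) where
  __ := (inferInstance : CommRing (KM M))
  __ := IsField.toField (R := KM M) ⟨⟨0, 1, zero_lt_one'.ne⟩, mul_comm, exists_inv⟩

instance : IsStrictOrderedRing (KM M) :=
  have h1 : ∀ p q : KM M, p ≤ q → ∀ r, p + r ≤ q + r := fun p q h r => by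
    rcases h with h | rfl
    · refine Or.inl ((lt_iff_sub_pos _ _).2 ?_)
      rw [lt_iff_sub_pos] at h
      simpa using h
    · exact Or.inr rfl
  haveI : IsOrderedAddMonoid (KM M) := ⟨h1, fun p q h r => by
    rw [add_comm r p, add_comm r q]
    exact h1 p q h r⟩
  haveI : ZeroLEOneClass (KM M) := ⟨zero_lt_one'.le⟩
  .of_mul_pos fun _ _ => pos_mul

end KM

end Reals

end TrueArith

/-!
The field `K_M` is definably complete: a bounded lower set `S` of `K_M` that contains `0` has a
supremum whenever the set of pairs `(i, j)` with `i / (j + 1) ∈ S` is definable in `M`. Indeed the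
least number principle transfers from `ℕ` to all sets definable in `M` with parameters, so for each
`k` there is a least `f k` with `f k / (k + 1) ∉ S`. The function `f` is definable, the fractions
`f k / (k + 1)` and `f l / (l + 1)` are within `1 / (k + 1) + 1 / (l + 1)` of each other, hence the
sequence converges, and its limit is the supremum (`KM.exists_sup_of_definable`).

Let `P` be a polynomial over `K_M` with positive leading coefficient and `P 0 < 0`. The value
`P (i / (j + 1))` is represented by a sequence of fractions that is definable jointly in `i`, `j`
and the index, and positivity in `K_M` is a first-order condition on a representing sequence; so the
set of `(i, j)` with `P (i / (j + 1)) < 0` is definable (`DefinableKM.eval`,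
`DefinableKM.definable_neg`). Definable completeness then gives the supremum of the initial segment
on which all nonnegative fractions make `P` negative, and continuity of `P` forces it to be a root
(`KM.exists_isRoot_of_eval_zero_neg`). By translation it is enough that `P` takes a negative value
somewhere. This covers polynomials of odd degree, up to sign, and `X ^ 2 - p` for `p > 0`.
-/

namespace TrueArith

universe u

variable {M : Type u} [LPA.Structure M] [M ⊨ ThNat]

open MInt FracM

/-! ### The least number principle for definable sets -/

/-- A definition uses finitely many parameters; with these as free variables, the least number
principle for the defining formula holds in `ℕ` for all values of the variables, so it transfers to
`M`. -/
theorem exists_least_of_definable {s : Set (Fin 1 → M)}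
    (hs : (Set.univ : Set M).Definable LPA s) {a : M} (ha : (fun _ => a) ∈ s) :
    ∃ b, (fun _ => b) ∈ s ∧ ∀ c < b, (fun _ => c) ∉ s := by
  obtain ⟨A, -, hA⟩ := Set.definable_iff_finitely_definable.1 hs
  obtain ⟨φ, rfl⟩ := Set.definable_iff_exists_formula_sum.1 hA
  obtain ⟨n, ⟨e⟩⟩ := Finite.exists_equiv_fin (A : Set M)
  let ψ : LPA.Formula (Fin n ⊕ Fin 1) := φ.relabel (Sum.map e id)
  let χ : LPA.Formula (Fin n) := (ψ.iExs (Fin 1)).imp (Formula.iExs (Fin 1)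
    (ψ ⊓ Formula.iAlls (Fin 1) ((ψ.relabel (Sum.map Sum.inl id)).imp
      (tlt (Term.var (Sum.inr 0)) (Term.var (Sum.inl (Sum.inr 0)))).not)))
  have hχ : ∀ v : Fin n → ℕ, χ.Realize v := by
    intro v
    simp only [χ, Formula.realize_imp, Formula.realize_iExs, Formula.realize_inf,
      Formula.realize_iAlls, Formula.realize_relabel, Formula.realize_not, nat_tlt,
      Term.realize_var]
    rintro ⟨i, hi⟩
    classical
    have hex : ∃ b : ℕ, ψ.Realize (Sum.elim v fun _ : Fin 1 => b) :=
      ⟨i 0, by convert hi using 2; funext k; rw [Subsingleton.elim k 0]⟩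
    refine ⟨fun _ => Nat.find hex, Nat.find_spec hex, fun j hj hlt => ?_⟩
    refine Nat.find_min hex hlt ?_
    convert hj using 1
    funext k
    rcases k with k | k
    · rfl
    · simp [Subsingleton.elim k 0]
  have hM := transfer χ hχ (fun k => (e.symm k : M))
  simp only [χ, Formula.realize_imp, Formula.realize_iExs, Formula.realize_inf,
      Formula.realize_iAlls, Formula.realize_relabel, Formula.realize_not, re_tlt,
      Term.realize_var] at hM
  have key : ∀ b : M, ψ.Realize (Sum.elim (fun k => (e.symm k : M)) fun _ : Fin 1 => b) ↔
      φ.Realize (Sum.elim (fun x : (A : Set M) => (x : M)) fun _ : Fin 1 => b) := by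
    intro b
    simp only [ψ, Formula.realize_relabel]
    apply iff_of_eq
    congr 1
    funext k
    rcases k with k | k <;> simp
  obtain ⟨i, hi, hmin⟩ := hM ⟨fun _ => a, (key a).2 ha⟩
  have hi0 : i = fun _ => i 0 := by funext k; rw [Subsingleton.elim k 0]
  refine ⟨i 0, ?_, fun c hc h => hmin (fun _ => c) ?_ hc⟩
  · rw [hi0] at hi
    exact (key _).1 hi
  · have := (key c).2 h
    convert this using 1
    funext k
    rcases k with k | k <;> rfl

/-! ### Definable inequalities -/

section Definable

variable {α : Type} {f g : (α → M) → M}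

theorem definable_lt (hf : (Set.univ : Set M).DefinableFun LPA f)
    (hg : (Set.univ : Set M).DefinableFun LPA g) :
    (Set.univ : Set M).Definable LPA {v | f v < g v} := by
  have h : (Set.univ : Set M).Definable LPA {w : Fin 2 → M | w 0 < w 1} := by
    refine Set.Definable.mono (Set.empty_definable_iff.2 ⟨tlt (Term.var 0) (Term.var 1), ?_⟩)
      (Set.empty_subset _)
    ext w
    simp [re_tlt]
  have hF : (Set.univ : Set M).DefinableMap LPA (fun v => ![f v, g v]) := by
    intro i
    fin_cases i <;> assumption
  exact h.preimage_map hF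

theorem definable_le (hf : (Set.univ : Set M).DefinableFun LPA f)
    (hg : (Set.univ : Set M).DefinableFun LPA g) :
    (Set.univ : Set M).Definable LPA {v | f v ≤ g v} := by
  convert (definable_lt hg hf).compl using 1
  ext v
  simp

set_option linter.unusedSectionVars false in
theorem definable_const (a : M) : (Set.univ : Set M).DefinableFun LPA (fun _ : α → M => a) :=
  LPA.definableFun_const _ (Set.mem_univ a)

set_option linter.unusedSectionVars false in
theorem definable_reindex {β : Type} [Finite α] (hf : (Set.univ : Set M).DefinableFun LPA f)
    (σ : α → β) : (Set.univ : Set M).DefinableFun LPA (fun w : β → M => f (w ∘ σ)) :=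
  Set.DefinableFun.comp (g := fun (w : β → M) => w ∘ σ)
    (fun _ => Set.DefinableFun.proj (L := LPA)) hf

end Definable

/-! ### The inclusion of `M` in `K_M` -/

theorem cst_add (a b : M) : cst (a + b) = cst a + cst b := by simp [cst]
theorem cst_mul (a b : M) : cst (a * b) = cst a * cst b := by simp [cst, of_mul]
theorem cst_one : cst (1 : M) = 1 := by simp [cst, of_one]
theorem cst_lt {a b : M} : cst a < cst b ↔ a < b := by rw [cst, cst, ι_lt, of_lt]

namespace KM

open MReal

/-- The inclusion of `M` in `K_M`. -/
noncomputable def ofM (a : M) : KM M := mk (const a)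

theorem ofM_add (a b : M) : ofM (a + b) = ofM a + ofM b :=
  mk_eq_of_seq (by rw [seq_add, seq_const, seq_const, seq_const]; funext; exact cst_add a b)

theorem ofM_mul (a b : M) : ofM (a * b) = ofM a * ofM b :=
  mk_eq_of_seq (by rw [seq_mul, seq_const, seq_const, seq_const]; funext; exact cst_mul a b)

theorem ofM_zero : ofM (0 : M) = 0 := rfl
theorem ofM_one : ofM (1 : M) = 1 := rfl

theorem ofM_strictMono : StrictMono (ofM (M := M)) := fun a b h => by
  rw [ofM, ofM, mk_lt, seq_const, seq_const]
  have h' : 0 < cst b - cst a := sub_pos.2 (cst_lt.2 h)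
  exact ⟨(cst b - cst a) / 2, half_pos h', 0, fun _ _ => half_lt_self h'⟩

theorem ofM_nonneg (a : M) : 0 ≤ ofM a := ofM_strictMono.monotone (zero_le' a)

theorem ofM_add_one_pos (a : M) : 0 < ofM (a + 1) :=
  ofM_strictMono (lt_of_le_of_lt (zero_le' a) (lt_add_one a))

/-- `M` is cofinal in `K_M`, as convergent sequences are bounded by elements of `M`. -/
theorem exists_lt_ofM (p : KM M) : ∃ a : M, p < ofM a := by
  obtain ⟨y, rfl⟩ := exists_mk p
  obtain ⟨B, hB, n, hn⟩ := y.cau.bounded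
  obtain ⟨m, -, hm⟩ := exists_cst (M := M) (ε := 1 / (B + 2)) (by positivity)
  refine ⟨m, ?_⟩
  rw [ofM, mk_lt, seq_const]
  refine ⟨1, one_pos, n, fun k hk => ?_⟩
  have h1 := (abs_lt.1 (hn k hk)).2
  rw [mul_one_div, one_le_div (by positivity)] at hm
  simp only [Pi.sub_apply]
  linarith

theorem exists_inv_ofM_lt {ε : KM M} (hε : 0 < ε) : ∃ k : M, 1 / ofM (k + 1) < ε := by
  obtain ⟨a, ha⟩ := exists_lt_ofM (1 / ε)
  refine ⟨a, ?_⟩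
  have h1 := ofM_strictMono (lt_add_one a)
  rw [one_div_lt (ofM_add_one_pos a) hε]
  exact ha.trans h1

/-- The fraction `i / (j + 1)`, as an element of `K_M`. -/
noncomputable def grid (i j : M) : KM M := ofM i / ofM (j + 1)

theorem grid_nonneg (i j : M) : 0 ≤ grid i j := div_nonneg (ofM_nonneg i) (ofM_nonneg _)

theorem grid_zero_left (j : M) : grid 0 j = 0 := by rw [grid, ofM_zero, zero_div]

theorem grid_le_grid {i j i' j' : M} :
    grid i j ≤ grid i' j' ↔ i * (j' + 1) ≤ i' * (j + 1) := by
  rw [grid, grid, div_le_div_iff₀ (ofM_add_one_pos _) (ofM_add_one_pos _), ← ofM_mul, ← ofM_mul,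
    ofM_strictMono.le_iff_le]

theorem grid_add_one (i j : M) : grid (i + 1) j = grid i j + 1 / ofM (j + 1) := by
  rw [grid, grid, ofM_add, ofM_one, add_div]

theorem grid_mul_add_one (i j : M) : grid (i * (j + 1)) j = ofM i := by
  rw [grid, ofM_mul, mul_div_cancel_right₀ _ (ofM_add_one_pos j).ne']

/-- The elements `i / (j + 1)` are the classes of the constant sequences of fractions. -/
theorem exists_mk_eq_grid (i j : M) :
    ∃ z : MReal M, (∀ k, z.seq k = cst i / cst (j + 1)) ∧ mk z = grid i j := by
  let y : PreReal M := (PreReal.const i).mul (PreReal.const (j + 1)).inv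
  have hs : y.seq = fun _ => cst i / cst (j + 1) := by
    rw [PreReal.seq_mul, PreReal.seq_inv, PreReal.seq_const, PreReal.seq_const]
    rfl
  let z : MReal M := ⟨y, by rw [PreReal.convergent_iff, hs]; exact Cau.const _⟩
  have hz : z.seq = fun _ => cst i / cst (j + 1) := hs
  refine ⟨z, fun k => by rw [hz], ?_⟩
  have hj : cst (j + 1) ≠ 0 := (cst_pos (add_pos_of_nonneg_of_pos (zero_le' j) one_pos).ne').ne'
  rw [grid, eq_div_iff (ofM_add_one_pos j).ne', ofM, ofM, mk_mul]
  refine mk_eq_of_seq ?_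
  rw [seq_mul, hz, seq_const, seq_const]
  funext k
  exact div_mul_cancel₀ _ hj

end KM

/-! ### Definable families of elements of `K_M` -/

section Families

variable {α : Type}

/-- A family of fractions, indexed by tuples of elements of `M`, that can be written as
`(p v - n v) / d v` with definable functions `p`, `n`, `d` into `M`. -/
def DefinableFrac (G : (α → M) → FracM M) : Prop :=
  ∃ p n d : (α → M) → M, (Set.univ : Set M).DefinableFun LPA p ∧
    (Set.univ : Set M).DefinableFun LPA n ∧ (Set.univ : Set M).DefinableFun LPA d ∧
    (∀ v, d v ≠ 0) ∧ ∀ v, G v = (cst (p v) - cst (n v)) / cst (d v)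

theorem DefinableFrac.add {G H : (α → M) → FracM M} (hG : DefinableFrac G)
    (hH : DefinableFrac H) : DefinableFrac (fun v => G v + H v) := by
  obtain ⟨p, n, d, hp, hn, hd, hd0, h⟩ := hG
  obtain ⟨p', n', d', hp', hn', hd', hd0', h'⟩ := hH
  refine ⟨fun v => p v * d' v + d v * p' v, fun v => n v * d' v + d v * n' v,
    fun v => d v * d' v, defAdd (defMul hp hd') (defMul hd hp'),
    defAdd (defMul hn hd') (defMul hd hn'), defMul hd hd',
    fun v => mul_ne_zero (hd0 v) (hd0' v), fun v => ?_⟩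
  have h1 := (cst_pos (hd0 v)).ne'
  have h2 := (cst_pos (hd0' v)).ne'
  beta_reduce
  rw [h, h', div_add_div _ _ h1 h2]
  simp only [cst_add, cst_mul]
  ring

theorem DefinableFrac.mul {G H : (α → M) → FracM M} (hG : DefinableFrac G)
    (hH : DefinableFrac H) : DefinableFrac (fun v => G v * H v) := by
  obtain ⟨p, n, d, hp, hn, hd, hd0, h⟩ := hG
  obtain ⟨p', n', d', hp', hn', hd', hd0', h'⟩ := hH
  refine ⟨fun v => p v * p' v + n v * n' v, fun v => p v * n' v + n v * p' v,
    fun v => d v * d' v, defAdd (defMul hp hp') (defMul hn hn'),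
    defAdd (defMul hp hn') (defMul hn hp'), defMul hd hd',
    fun v => mul_ne_zero (hd0 v) (hd0' v), fun v => ?_⟩
  beta_reduce
  rw [h, h', div_mul_div_comm]
  simp only [cst_add, cst_mul]
  ring

/-- A family of elements of `K_M`, indexed by tuples of elements of `M`, whose members have
representing sequences that form a definable family jointly with the index of the sequence. -/
def DefinableKM (g : (α → M) → KM M) : Prop :=
  ∃ G : (α ⊕ Fin 1 → M) → FracM M, DefinableFrac G ∧
    ∀ v, ∃ z : MReal M, (∀ k, z.seq k = G (Sum.elim v fun _ => k)) ∧ KM.mk z = g v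

theorem DefinableKM.const (p : KM M) : DefinableKM (fun _ : α → M => p) := by
  obtain ⟨y, rfl⟩ := KM.exists_mk p
  refine ⟨fun w => y.seq (w (Sum.inr 0)), ⟨_, _, _, y.1.defPart.at (Sum.inr 0),
    y.1.defPartNeg.at (Sum.inr 0), y.1.defDen.at (Sum.inr 0), fun _ => y.1.den_ne _, fun w => ?_⟩,
    fun v => ⟨y, fun k => rfl, rfl⟩⟩
  show ι M (y.1.num _) / _ = _
  conv_lhs => rw [eq_part_sub (y.1.num _), map_sub]

theorem DefinableKM.add {g h : (α → M) → KM M} (hg : DefinableKM g) (hh : DefinableKM h) :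
    DefinableKM (fun v => g v + h v) := by
  obtain ⟨G, hG, hg⟩ := hg
  obtain ⟨H, hH, hh⟩ := hh
  refine ⟨_, hG.add hH, fun v => ?_⟩
  obtain ⟨y, hy, hy'⟩ := hg v
  obtain ⟨z, hz, hz'⟩ := hh v
  refine ⟨y.add z, fun k => ?_, ?_⟩
  · rw [MReal.seq_add, Pi.add_apply, hy, hz]
  · rw [← KM.mk_add, hy', hz']

theorem DefinableKM.mul {g h : (α → M) → KM M} (hg : DefinableKM g) (hh : DefinableKM h) :
    DefinableKM (fun v => g v * h v) := by
  obtain ⟨G, hG, hg⟩ := hg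
  obtain ⟨H, hH, hh⟩ := hh
  refine ⟨_, hG.mul hH, fun v => ?_⟩
  obtain ⟨y, hy, hy'⟩ := hg v
  obtain ⟨z, hz, hz'⟩ := hh v
  refine ⟨y.mul z, fun k => ?_, ?_⟩
  · rw [MReal.seq_mul, Pi.mul_apply, hy, hz]
  · rw [← KM.mk_mul, hy', hz']

theorem definableKM_grid (a b : α) : DefinableKM (fun v : α → M => KM.grid (v a) (v b)) := by
  refine ⟨fun w => cst (w (Sum.inl a)) / cst ((w (Sum.inl b) : M) + 1),
    ⟨fun w => w (Sum.inl a), fun _ => 0, fun w => w (Sum.inl b) + 1,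
      Set.DefinableFun.proj (L := LPA), definable_const 0,
      defAdd (Set.DefinableFun.proj (L := LPA)) (definable_const 1),
      fun w => (add_pos_of_nonneg_of_pos (zero_le' _) one_pos).ne', fun w => by
        simp [cst]⟩, fun v => ?_⟩
  obtain ⟨z, hz, hz'⟩ := KM.exists_mk_eq_grid (v a) (v b)
  exact ⟨z, hz, hz'⟩

theorem DefinableKM.eval {g : (α → M) → KM M} (hg : DefinableKM g) (P : Polynomial (KM M)) :
    DefinableKM (fun v => P.eval (g v)) := by
  induction P using Polynomial.induction_on with
  | C a => simpa using DefinableKM.const a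
  | add p q hp hq => simpa using hp.add hq
  | monomial n a h => simpa [pow_succ, mul_assoc] using h.mul hg

/-- Positivity of an element of `K_M` is expressed by a formula about a representing sequence. -/
theorem DefinableKM.definable_pos [Finite α] {g : (α → M) → KM M} (hg : DefinableKM g) :
    (Set.univ : Set M).Definable LPA {v | 0 < g v} := by
  obtain ⟨G, ⟨p, n, d, hp, hn, hd, hd0, hG⟩, hz⟩ := hg
  have key : ∀ (m : M) w, 1 < cst m * G w ↔ d w + m * n w < m * p w := by
    intro m w
    rw [hG, ← mul_div_assoc, one_lt_div (cst_pos (hd0 w)), ← cst_lt, cst_add, cst_mul, cst_mul,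
      mul_sub, lt_sub_iff_add_lt]
  have hpos : ∀ v, 0 < g v ↔ ∃ u : Fin 2 → M, ∀ t : Fin 1 → M, u 1 < t 0 →
      d (Sum.elim v t) + u 0 * n (Sum.elim v t) < u 0 * p (Sum.elim v t) := by
    intro v
    obtain ⟨z, hzG, hz⟩ := hz v
    have ht : ∀ t : Fin 1 → M, (fun _ => t 0) = t := fun t => by
      funext i; rw [Subsingleton.elim i 0]
    simp only [← key]
    rw [← hz, KM.mk_pos]
    constructor
    · rintro ⟨ε, hε, l, hl⟩
      obtain ⟨m, hm, hm'⟩ := exists_cst hε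
      refine ⟨![m, l], fun t htl => ?_⟩
      have := hl (t 0) htl
      rw [hzG, ht] at this
      exact hm'.trans_lt (mul_lt_mul_of_pos_left this hm)
    · rintro ⟨u, hu⟩
      refine ⟨1 / (cst (u 0) + 1), ?_, u 1, fun k hk => ?_⟩
      · have := cst_nonneg (u 0)
        positivity
      · have h1 := hu (fun _ => k) hk
        rw [← hzG] at h1
        have h0 := cst_nonneg (u 0)
        have h2 : 0 < z.seq k := by
          by_contra hn
          nlinarith [mul_nonneg h0 (neg_nonneg.2 (not_lt.1 hn))]
        rw [div_lt_iff₀ (by positivity)]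
        linarith
  simp only [hpos]
  -- the variables are the tuple `v`, the bounds `u` (a multiplier and an index) and the index `t`
  let σ : α ⊕ Fin 1 → (α ⊕ Fin 2) ⊕ Fin 1 := Sum.map Sum.inl id
  have h1 : (Set.univ : Set M).Definable LPA {w : (α ⊕ Fin 2) ⊕ Fin 1 → M |
      w (Sum.inl (Sum.inr 1)) < w (Sum.inr 0)} :=
    definable_lt (Set.DefinableFun.proj (L := LPA)) (Set.DefinableFun.proj (L := LPA))
  have h2 := definable_lt
    (defAdd (definable_reindex hd σ) (defMul (Set.DefinableFun.proj (L := LPA)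
      (i := Sum.inl (Sum.inr 0))) (definable_reindex hn σ)))
    (defMul (Set.DefinableFun.proj (L := LPA) (i := Sum.inl (Sum.inr 0)))
      (definable_reindex hp σ))
  convert ((h1.compl.union h2).forall_of_finite (α := α ⊕ Fin 2)
    (β := Fin 1)).exists_of_finite using 1
  have hσ : ∀ (v : α → M) (u : Fin 2 → M) (t : Fin 1 → M),
      Sum.elim (Sum.elim v u) t ∘ σ = Sum.elim v t := by
    intro v u t
    funext i
    rcases i with i | i <;> rfl
  ext v
  simp [hσ, imp_iff_not_or]

theorem DefinableKM.definable_neg [Finite α] {g : (α → M) → KM M} (hg : DefinableKM g) :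
    (Set.univ : Set M).Definable LPA {v | g v < 0} := by
  convert ((DefinableKM.const (-1)).mul hg).definable_pos using 3
  simp

end Families

/-! ### Definable completeness -/

namespace KM

open MReal

/-- A lower set of `K_M` that contains `0`, omits some element of `M` and has a definable trace on
the fractions has a supremum: on the grid of width `1 / (k + 1)` take the least point outside the
set. The supremum is moreover approached by fractions from the set. -/
theorem exists_sup_of_definable {S : Set (KM M)} (hS : IsLowerSet S)
    (hdef : (Set.univ : Set M).Definable LPA {v : Fin 2 → M | grid (v 0) (v 1) ∈ S})
    (h0 : 0 ∈ S) {N : M} (hN : ofM N ∉ S) :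
    ∃ p : KM M, (∀ s ∈ S, s ≤ p) ∧ ∀ q < p, ∃ i j, q < grid i j ∧ grid i j ∈ S := by
  have hex : ∀ k : M, ∃ i : M, grid i k ∉ S ∧ ∀ i' < i, grid i' k ∈ S := by
    intro k
    have hk : (Set.univ : Set M).Definable LPA {v : Fin 1 → M | grid (v 0) k ∉ S} := by
      have hF : (Set.univ : Set M).DefinableMap LPA (fun v : Fin 1 → M => ![v 0, k]) := by
        intro i
        fin_cases i
        · exact Set.DefinableFun.proj (L := LPA)
        · exact definable_const k
      exact (hdef.preimage_map hF).compl
    obtain ⟨b, hb, hb'⟩ := exists_least_of_definable hk (a := N * (k + 1)) (by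
      show grid _ _ ∉ S
      rwa [grid_mul_add_one])
    exact ⟨b, hb, fun c hc => not_not.1 (hb' c hc)⟩
  choose f hf hf' using hex
  have hpos : ∀ k, f k ≠ 0 := fun k h => hf k (by rwa [h, grid_zero_left])
  have hf1 : ∀ k, ∃ e, f k = e + 1 ∧ grid e k ∈ S := fun k => by
    obtain ⟨c, hc⟩ : ∃ c, f k = c + 1 := by
      rcases (one_le_of_ne (hpos k)).lt_or_eq with h | h
      · obtain ⟨c, hc⟩ := exists_add' _ _ h
        exact ⟨c, by rw [hc, add_comm]⟩
      · exact ⟨0, by rw [zero_add, h]⟩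
    exact ⟨c, hc, hf' k c (by rw [hc]; exact lt_add_one c)⟩
  -- two grids compare: `f l / (l + 1) < f k / (k + 1) + 1 / (l + 1)`
  have hcomp : ∀ k l, f l * (k + 1) < f k * (l + 1) + (k + 1) := by
    intro k l
    obtain ⟨e, he, heS⟩ := hf1 l
    have h1 : grid e l < grid (f k) k := by
      by_contra hn
      exact hf k (hS (not_lt.1 hn) heS)
    rw [← not_le, grid_le_grid, not_le] at h1
    rw [he, add_mul, one_mul]
    exact add_lt_add_left h1 _
  have hcomp' : ∀ k l, cst (f l) / cst (l + 1) < cst (f k) / cst (k + 1) + 1 / cst (l + 1) := by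
    intro k l
    have hk : 0 < cst (k + 1) := cst_pos (add_pos_of_nonneg_of_pos (zero_le' k) one_pos).ne'
    have hl : 0 < cst (l + 1) := cst_pos (add_pos_of_nonneg_of_pos (zero_le' l) one_pos).ne'
    have h1 := cst_lt.2 (hcomp k l)
    rw [cst_add, cst_mul, cst_mul] at h1
    rw [div_add_div _ _ hk.ne' hl.ne', div_lt_div_iff₀ hl (by positivity)]
    nlinarith
  have hfdef : DefFun f := by
    have h1 : (Set.univ : Set M).Definable LPA
        {w : Option (Fin 1) → M | grid (w none) (w (some 0)) ∉ S} :=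
      (hdef.preimage_comp ![none, some 0]).compl
    have h2 : (Set.univ : Set M).Definable LPA
        {w : Option (Fin 1) ⊕ Fin 1 → M | w (Sum.inr 0) < w (Sum.inl none)} :=
      definable_lt (Set.DefinableFun.proj (L := LPA)) (Set.DefinableFun.proj (L := LPA))
    have h3 : (Set.univ : Set M).Definable LPA
        {w : Option (Fin 1) ⊕ Fin 1 → M | grid (w (Sum.inr 0)) (w (Sum.inl (some 0))) ∈ S} :=
      hdef.preimage_comp ![Sum.inr 0, Sum.inl (some 0)]
    unfold DefFun Set.DefinableFun
    convert h1.inter (h2.compl.union h3).forall_of_finite using 1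
    ext w
    simp only [Function.tupleGraph, Set.mem_ofPred_eq, Set.mem_inter_iff, Set.mem_union,
      Set.mem_compl_iff, Sum.elim_inl, Sum.elim_inr, ← imp_iff_not_or]
    show f (w (some 0)) = w none ↔ _
    constructor
    · intro h
      rw [← h]
      exact ⟨hf _, fun u hu => hf' _ _ hu⟩
    · rintro ⟨h, h'⟩
      rcases lt_trichotomy (f (w (some 0))) (w none) with hlt | heq | hgt
      · exact absurd (h' (fun _ => f (w (some 0))) hlt) (hf _)
      · exact heq
      · exact absurd (hf' _ _ hgt) h
  have hsucc : DefFun (fun k : M => k + 1) :=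
    defAdd (Set.DefinableFun.proj (L := LPA)) (definable_const 1)
  let x : PreReal M :=
    { num := fun k => of M (f k)
      den := fun k => k + 1
      den_ne := fun k => (add_pos_of_nonneg_of_pos (zero_le' k) one_pos).ne'
      definable_pos := definable_pos_of hfdef (.const 0) hsucc
        (num := fun k => of M (f k)) (fun _ => by simp)
      definable_neg := definable_neg_of hfdef (.const 0) hsucc
        (num := fun k => of M (f k)) (fun _ => by simp) }
  have hxs : ∀ k, x.seq k = cst (f k) / cst (k + 1) := fun k => rfl
  have hsmall : ∀ ε : FracM M, 0 < ε → ∃ n, ∀ k > n, 1 / cst (k + 1) < ε := by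
    intro ε hε
    obtain ⟨m, hm, hm'⟩ := exists_cst hε
    refine ⟨m, fun k hk => ?_⟩
    have h1 : cst m < cst (k + 1) := cst_lt.2 (hk.trans (lt_add_one k))
    rw [div_lt_iff₀ (hm.trans h1), mul_comm]
    exact hm'.trans_lt (mul_lt_mul_of_pos_right h1 hε)
  have hcau : Cau x.seq := by
    intro ε hε
    obtain ⟨n, hn⟩ := hsmall ε hε
    refine ⟨n, fun k hk l hl => abs_sub_lt_iff.2 ⟨?_, ?_⟩⟩
    · have := hcomp' l k
      rw [hxs, hxs]
      linarith [hn k hk]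
    · have := hcomp' k l
      rw [hxs, hxs]
      linarith [hn l hl]
  let z : MReal M := ⟨x, x.convergent_iff.2 hcau⟩
  have hzs : ∀ k, z.seq k = cst (f k) / cst (k + 1) := hxs
  have hle : ∀ k, mk z ≤ grid (f k) k := by
    intro k
    obtain ⟨y, hy, hy'⟩ := exists_mk_eq_grid (f k) k
    rw [← hy', ← not_lt, mk_lt]
    rintro ⟨ε, hε, n, hn⟩
    obtain ⟨n', hn'⟩ := hsmall ε hε
    obtain ⟨l, hl⟩ := exists_gt (max n n')
    have h1 := hn l ((le_max_left _ _).trans_lt hl)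
    have h2 := hn' l ((le_max_right _ _).trans_lt hl)
    rw [Pi.sub_apply, hy, hzs] at h1
    linarith [hcomp' k l]
  have hge : ∀ k e, f k = e + 1 → grid e k ≤ mk z := by
    intro k e he
    obtain ⟨y, hy, hy'⟩ := exists_mk_eq_grid e k
    rw [← hy', ← not_lt, mk_lt]
    rintro ⟨ε, hε, n, hn⟩
    obtain ⟨l, hl⟩ := exists_gt n
    have h1 := hn l hl
    have h2 := hcomp' l k
    rw [Pi.sub_apply, hy, hzs] at h1
    rw [he, cst_add, cst_one, add_div] at h2
    linarith
  refine ⟨mk z, fun s hs => ?_, fun q hq => ?_⟩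
  · by_contra hlt
    obtain ⟨k, hk⟩ := exists_inv_ofM_lt (sub_pos.2 (not_le.1 hlt))
    obtain ⟨e, he, -⟩ := hf1 k
    have h1 := hge k e he
    refine hf k (hS ?_ hs)
    rw [he, grid_add_one]
    linarith
  · obtain ⟨k, hk⟩ := exists_inv_ofM_lt (sub_pos.2 hq)
    obtain ⟨e, he, heS⟩ := hf1 k
    refine ⟨e, k, ?_, heS⟩
    have h1 := hle k
    rw [he, grid_add_one] at h1
    linarith

end KM

/-! ### Signs of polynomials over an ordered field -/

section OrderedField

open Polynomial

variable {F : Type*} [Field F] [LinearOrder F] [IsStrictOrderedRing F]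

/-- Induction on the degree through `P = X * Q + a`: a positive lower bound for `Q`, rather than mere
positivity, is what lets `X * Q` outweigh `a`. -/
theorem exists_forall_ge_le_eval (P : F[X]) (hP : 0 < P.leadingCoeff) :
    ∃ c > 0, ∃ B, ∀ t ≥ B, c ≤ P.eval t := by
  induction hn : P.natDegree generalizing P with
  | zero =>
    rw [natDegree_eq_zero] at hn
    obtain ⟨a, rfl⟩ := hn
    rw [leadingCoeff_C] at hP
    exact ⟨a, hP, 0, fun t _ => by rw [eval_C]⟩
  | succ n ih =>
    have hd : P.divX.natDegree = n := by rw [natDegree_divX_eq_natDegree_tsub_one, hn]; rfl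
    have hl : P.divX.leadingCoeff = P.leadingCoeff := by
      rw [leadingCoeff, hd, coeff_divX, leadingCoeff, hn]
    obtain ⟨c, hc, B, hB⟩ := ih P.divX (hl ▸ hP) hd
    refine ⟨1, one_pos, max B (max 0 ((1 + |P.coeff 0|) / c)), fun t ht => ?_⟩
    simp only [ge_iff_le, max_le_iff] at ht
    obtain ⟨h1, h2, h3⟩ := ht
    rw [div_le_iff₀ hc] at h3
    have h4 := mul_le_mul_of_nonneg_left (hB t h1) h2
    have h5 := neg_abs_le (P.coeff 0)
    conv_rhs => rw [← P.divX_mul_X_add]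
    rw [eval_add, eval_mul, eval_X, eval_C]
    linarith

theorem exists_eval_neg_of_odd {P : F[X]} (hodd : Odd P.natDegree) (hP : 0 < P.leadingCoeff) :
    ∃ a, P.eval a < 0 := by
  have hl : (-(P.comp (-X))).leadingCoeff = P.leadingCoeff := by
    rw [leadingCoeff_neg, leadingCoeff_comp (by simp), leadingCoeff_neg, leadingCoeff_X,
      hodd.neg_one_pow]
    ring
  obtain ⟨c, hc, B, hB⟩ := exists_forall_ge_le_eval (-(P.comp (-X))) (hl ▸ hP)
  refine ⟨-B, ?_⟩
  have := hB B le_rfl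
  simp only [eval_neg, eval_comp, eval_X] at this
  linarith

theorem exists_pos_eval_pos_near {P : F[X]} {t : F} (h : 0 < P.eval t) :
    ∃ δ > 0, ∀ s, |s - t| < δ → 0 < P.eval s := by
  let : TopologicalSpace F := Preorder.topology F
  have : OrderTopology F := ⟨rfl⟩
  have := P.continuous.continuousAt.eventually (lt_mem_nhds h)
  exact (nhds_basis_abs_sub_lt t).mem_iff.1 this

end OrderedField

/-! ### Roots of polynomials over `K_M` -/

namespace KM

open Polynomial

/-- The root is the supremum of the initial segment on which all nonnegative fractions make the
polynomial negative. -/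
theorem exists_isRoot_of_eval_zero_neg {P : (KM M)[X]} (hP : 0 < P.leadingCoeff)
    (h0 : P.eval 0 < 0) : ∃ t, P.IsRoot t := by
  let S : Set (KM M) := {y | ∀ i j, grid i j ≤ y → P.eval (grid i j) < 0}
  have hS : IsLowerSet S := fun a b hba ha i j hij => ha i j (hij.trans hba)
  have h0S : (0 : KM M) ∈ S := fun i j hij => by
    rwa [le_antisymm hij (grid_nonneg i j)]
  obtain ⟨N, hN⟩ : ∃ N, ofM N ∉ S := by
    obtain ⟨c, hc, B, hB⟩ := exists_forall_ge_le_eval P hP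
    obtain ⟨N, hN⟩ := exists_lt_ofM B
    refine ⟨N, fun h => ?_⟩
    have h1 := h (N * (0 + 1)) 0 (grid_mul_add_one N 0).le
    rw [grid_mul_add_one] at h1
    linarith [hB _ hN.le]
  have hdef : (Set.univ : Set M).Definable LPA {v : Fin 2 → M | grid (v 0) (v 1) ∈ S} := by
    have h1 : (Set.univ : Set M).Definable LPA {w : Fin 2 ⊕ Fin 2 → M |
        w (Sum.inr 0) * (w (Sum.inl 1) + 1) ≤ w (Sum.inl 0) * (w (Sum.inr 1) + 1)} :=
      definable_le
        (defMul (Set.DefinableFun.proj (L := LPA))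
          (defAdd (Set.DefinableFun.proj (L := LPA)) (definable_const 1)))
        (defMul (Set.DefinableFun.proj (L := LPA))
          (defAdd (Set.DefinableFun.proj (L := LPA)) (definable_const 1)))
    have h2 := ((definableKM_grid (M := M) (Sum.inr 0 : Fin 2 ⊕ Fin 2) (Sum.inr 1)).eval
      P).definable_neg
    convert (h1.compl.union h2).forall_of_finite using 1
    ext v
    simp only [S, Set.mem_ofPred_eq, Set.mem_union, Set.mem_compl_iff, Sum.elim_inl,
      Sum.elim_inr, ← imp_iff_not_or, grid_le_grid]
    exact ⟨fun h u => h (u 0) (u 1), fun h i j => h ![i, j]⟩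
  obtain ⟨t, hub, happ⟩ := exists_sup_of_definable hS hdef h0S hN
  refine ⟨t, ?_⟩
  rcases lt_trichotomy (P.eval t) 0 with h | h | h
  · obtain ⟨δ, hδ, hnear⟩ := exists_pos_eval_pos_near (P := -P) (t := t) (by simpa using h)
    have hmem : t + δ / 2 ∈ S := by
      intro i j hij
      rcases lt_or_ge (grid i j) t with hlt | hge
      · obtain ⟨i', j', h1, h2⟩ := happ _ hlt
        exact h2 i j h1.le
      · have := hnear (grid i j) (by rw [abs_lt]; constructor <;> linarith)
        simpa using this
    linarith [hub _ hmem]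
  · exact h
  · obtain ⟨δ, hδ, hnear⟩ := exists_pos_eval_pos_near h
    obtain ⟨i, j, h1, h2⟩ := happ (t - δ) (by linarith)
    have h3 := hub _ h2
    have h4 := hnear (grid i j) (by rw [abs_lt]; constructor <;> linarith)
    exact absurd (h2 i j le_rfl) h4.not_gt

theorem exists_isRoot_of_eval_neg {P : (KM M)[X]} (hP : 0 < P.leadingCoeff) {a : KM M}
    (ha : P.eval a < 0) : ∃ t, P.IsRoot t := by
  obtain ⟨t, ht⟩ := exists_isRoot_of_eval_zero_neg (P := P.comp (X + C a))
    (by rw [leadingCoeff_comp (by simp)]; simpa using hP) (by simpa using ha)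
  exact ⟨t + a, by simpa [IsRoot] using ht⟩

theorem exists_isRoot_of_odd_natDegree {P : (KM M)[X]} (hodd : Odd P.natDegree) :
    ∃ t, P.IsRoot t := by
  have hne : P.leadingCoeff ≠ 0 := by
    rw [Ne, leadingCoeff_eq_zero]
    rintro rfl
    simp at hodd
  rcases lt_or_gt_of_ne hne with h | h
  · have h' : 0 < (-P).leadingCoeff := by simpa using h
    obtain ⟨a, ha⟩ := exists_eval_neg_of_odd (by rwa [natDegree_neg]) h'
    obtain ⟨t, ht⟩ := exists_isRoot_of_eval_neg h' ha
    exact ⟨t, by simpa [IsRoot] using ht⟩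
  · obtain ⟨a, ha⟩ := exists_eval_neg_of_odd hodd h
    exact exists_isRoot_of_eval_neg h ha

theorem isSquare_of_nonneg {p : KM M} (hp : 0 ≤ p) : IsSquare p := by
  rcases hp.eq_or_lt with rfl | hp
  · exact IsSquare.zero
  · obtain ⟨t, ht⟩ := exists_isRoot_of_eval_neg (P := X ^ 2 - C p) (a := 0)
      (by rw [leadingCoeff_X_pow_sub_C two_pos]; exact one_pos) (by simpa using hp)
    refine ⟨t, ?_⟩
    simp only [IsRoot, eval_sub, eval_pow, eval_X, eval_C] at ht
    linear_combination -ht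

end KM

end TrueArith

/-- For every model `M` of true arithmetic, the ordered field `K_M` is real closed. -/
theorem mainTheorem4 (M : Type*) [LPA.Structure M] [M ⊨ ThNat] :
    IsRealClosed (TrueArith.KM M) :=
  IsRealClosed.of_linearOrderedField TrueArith.KM.isSquare_of_nonneg
    TrueArith.KM.exists_isRoot_of_odd_natDegree
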